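/- Let $p$ be a prime and let $a,b$ be integers with $1\le a-b\le p$ (in particular any $0\le b<a\le p-1$). Let $\mathcal O$ be a discrete valuation ring with maximal ideal $\mathfrak m$, fraction field $E$ of characteristic $0$ and residue field $k$ of characteristic $p$ (for example the ring of integers of a finite extension of $\mathbb Q_p$), and let $\Omega$ be an extension field of $E$ together with a ring homomorphism $j$ from the Witt ring $W(\mathbb F_{p^2})$ to the integral closure of $\mathcal O$ in $\Omega$ and a nontrivial additive character $\psi:\mathbb F_p\to\Omega^\times$ (for example $\Omega=\overline{\mathbb Q}_p$). Let $\chi:\mathbb F_{p^2}^\times\to\Omega^\times$ be the character $\chi(x)=[x]^a[\bar x]^b$, where $[\,\cdot\,]$ is the Teichmüller lift to $W(\mathbb F_{p^2})^\times$ followed by $j$, and $\bar x=x^p$; then $\chi\ne\chi^p$. Let $Ds(\chi)$ be the cuspidal representation of $\mathrm{GL}_2(\mathbb F_p)$ over $\Omega$ attached to $\chi$, that is, the $(p-1)$-dimensional irreducible representation on the functions $f:\mathbb F_p^\times\to\Omega$ in which $g=\begin{pmatrix}\alpha&\beta\\ \gamma&\delta\end{pmatrix}$ acts by $(gf)(x)=\chi(\delta)\,\psi(\beta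 x/\delta)\,f(\alpha x/\delta)$ if $\gamma=0$, and by $$(gf)(x)=-\frac1p\sum_{y\in\mathbb F_p^\times}\psi\Big(\frac{\alpha x+\delta y}{\gamma}\Big)\sum_{t\in\mathbb F_{p^2},\ t\bar t=xy^{-1}\det g}\psi\Big(-\frac{y}{\gamma}(t+\bar t)\Big)\chi(t)\;f(y)$$ if $\gamma\neq0$ (so that its trace at an element with eigenvalues $t,\bar t\in\mathbb F_{p^2}\setminus\mathbb F_p$ is $-\chi(t)-\chi(\bar t)$). Let $\rho$ be a representation of $\mathrm{GL}_2(\mathbb F_p)$ on an $E$-vector space $M$ with $M\otimes_E\Omega\cong Ds(\chi)$, and let $L\subset M$ be any $\mathrm{GL}_2(\mathbb F_p)$-stable $\mathcal O$-lattice (a finitely generated $\mathcal O$-submodule that spans $M$ over $E$). Then the Jordan–Hölder factors, with multiplicity, of the representation of $\mathrm{GL}_2(\mathbb F_p)$ on $L/\mathfrak mL$ over $k$ are $$\det{}^{b+1}\otimes\operatorname{Sym}^{a-b-2}V\qquad\text{and}\qquad\det{}^{a}\otimes\operatorname{Sym}^{p-1-(a-b)}V,$$ where $V=k^2$ is the standard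 representation and $\operatorname{Sym}^{-1}V=0$ (so that for $a-b=1$ or $a-b=p$ the corresponding zero representation is omitted and $L/\mathfrak mL$ is irreducible). -/

import Mathlib

open scoped MatrixGroups

noncomputable section

namespace CuspidalGL2

section Kirillov

variable {p : ℕ} [Fact p.Prime] {Ω : Type*} [Field Ω]

/-- The elements of `𝔽_{p²}` of norm `n` to `𝔽_p`. -/
def normFiber (n : ZMod p) : Finset (GaloisField p 2) :=
  (Set.toFinite {t : GaloisField p 2 | Algebra.norm (ZMod p) t = n}).toFinset

/-- The kernel of the action of `g = (a b; c d)` on the Kirillov model of the cuspidal representation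
attached to `χ`: on functions `f : 𝔽_pˣ → Ω`, `(g f)(x) = ∑_y k(x, y) f(y)`, where
* if `c = 0`, then `(g f)(x) = χ(d) ψ(b x / d) f(a x / d)`;
* if `c ≠ 0`, then `k(x, y) = -p⁻¹ ψ((a x + d y) / c) ∑_{N t = (x / y) det g} ψ(-(y / c) Tr t) χ(t)`,
  the sum being over `t ∈ 𝔽_{p²}`. -/
def kirillovKernel (χ : MulChar (GaloisField p 2) Ω) (ψ : AddChar (ZMod p) Ω)
    (g : GL (Fin 2) (ZMod p)) : Matrix (ZMod p)ˣ (ZMod p)ˣ Ω := fun x y =>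
  if g 1 0 = 0 then
    if g 0 0 * (x : ZMod p) = g 1 1 * (y : ZMod p) then
      χ (algebraMap (ZMod p) (GaloisField p 2) (g 1 1)) * ψ (g 0 1 * (x : ZMod p) / g 1 1)
    else 0
  else
    -(p : Ω)⁻¹ * ψ ((g 0 0 * (x : ZMod p) + g 1 1 * (y : ZMod p)) / g 1 0) *
      ∑ t ∈ normFiber ((x : ZMod p) / (y : ZMod p) * g.val.det),
        ψ (-((y : ZMod p) / g 1 0) * Algebra.trace (ZMod p) (GaloisField p 2) t) * χ t

lemma norm_eq (t : GaloisField p 2) :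
    algebraMap (ZMod p) (GaloisField p 2) (Algebra.norm (ZMod p) t) = t * t ^ p := by
  rw [FiniteField.algebraMap_norm_eq_prod_pow, GaloisField.finrank p two_ne_zero]
  simp [Finset.prod_range_succ]

lemma trace_eq (t : GaloisField p 2) :
    algebraMap (ZMod p) (GaloisField p 2) (Algebra.trace (ZMod p) (GaloisField p 2) t)
      = t + t ^ p := by
  rw [FiniteField.algebraMap_trace_eq_sum_pow, GaloisField.finrank p two_ne_zero]
  simp [Finset.sum_range_succ]

lemma conj_conj (t : GaloisField p 2) : (t ^ p) ^ p = t := by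
  have : Fintype (GaloisField p 2) := Fintype.ofFinite _
  have h := FiniteField.pow_card t
  rw [← Nat.card_eq_fintype_card, GaloisField.card p 2 two_ne_zero] at h
  rw [← pow_mul, ← pow_two, h]

lemma conj_base (a : ZMod p) : (algebraMap (ZMod p) (GaloisField p 2) a) ^ p
    = algebraMap (ZMod p) (GaloisField p 2) a := by
  rw [← map_pow, ZMod.pow_card]

lemma conj_add (s t : GaloisField p 2) : (s + t) ^ p = s ^ p + t ^ p := add_pow_char _ _ _

lemma mem_normFiber {n : ZMod p} {t : GaloisField p 2} :
    t ∈ normFiber n ↔ Algebra.norm (ZMod p) t = n := by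
  simp [normFiber]
lemma sum_normFiber_eq_zero {χ : MulChar (GaloisField p 2) Ω} (hχ : χ ^ p ≠ χ) (n : ZMod p) :
    n ≠ 0 → ∑ r ∈ normFiber n, χ r = 0 := by
  intro hn
  have hx : ∃ x : (GaloisField p 2)ˣ, χ (x : GaloisField p 2) ^ p ≠ χ x := by
    by_contra! h
    exact hχ (MulChar.ext fun x => by rw [MulChar.pow_apply_coe, h x])
  obtain ⟨x, hx⟩ := hx
  have hx0 : (x : GaloisField p 2) ≠ 0 := x.ne_zero
  set u : GaloisField p 2 := (x : GaloisField p 2) ^ p / x with hu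
  have hu0 : u ≠ 0 := div_ne_zero (pow_ne_zero _ hx0) hx0
  have hNu : Algebra.norm (ZMod p) u = 1 := by
    apply (algebraMap (ZMod p) (GaloisField p 2)).injective
    rw [norm_eq, hu, div_pow, conj_conj, map_one]
    field_simp
  have hχu : χ u ≠ 1 := by
    intro h
    apply hx
    rw [← map_pow, show (x : GaloisField p 2) ^ p = u * x by rw [hu]; field_simp, map_mul, h,
      one_mul]
  have key : χ u * ∑ r ∈ normFiber n, χ r = ∑ r ∈ normFiber n, χ r := by
    rw [Finset.mul_sum]
    refine Finset.sum_nbij' (fun r => u * r) (fun r => u⁻¹ * r) ?_ ?_ ?_ ?_ ?_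
    · intro r hr
      rw [mem_normFiber] at hr ⊢
      rw [map_mul, hNu, one_mul, hr]
    · intro r hr
      rw [mem_normFiber] at hr ⊢
      rw [map_mul, ← one_mul (Algebra.norm (ZMod p) u⁻¹), ← hNu, ← map_mul,
        mul_inv_cancel₀ hu0, map_one, one_mul, hr]
    · intro r _
      field_simp
    · intro r _
      field_simp
    · intro r _
      rw [map_mul]
  have h2 : (χ u - 1) * ∑ r ∈ normFiber n, χ r = 0 := by rw [sub_mul, key, one_mul, sub_self]
  exact (mul_eq_zero.mp h2).resolve_left (sub_ne_zero.mpr hχu)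

lemma sum_psi_norm [CharZero Ω] [Fintype (GaloisField p 2)] {ψ : AddChar (ZMod p) Ω} (hψ : ψ ≠ 1)
    {A : ZMod p} (hA : A ≠ 0) :
    ∑ s : GaloisField p 2, ψ (A * Algebra.norm (ZMod p) s) = -(p : Ω) := by
  have hp : p.Prime := Fact.out
  have hcard : Fintype.card (GaloisField p 2) = p ^ 2 := by
    rw [← Nat.card_eq_fintype_card, GaloisField.card p 2 two_ne_zero]
  have hconst : ∀ B : ZMod p, B ≠ 0 →
      ∑ s : GaloisField p 2, ψ (B * Algebra.norm (ZMod p) s)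
        = ∑ s : GaloisField p 2, ψ (A * Algebra.norm (ZMod p) s) := by
    intro B hB
    obtain ⟨u, hu⟩ := FiniteField.norm_surjective (ZMod p) (GaloisField p 2) (B / A)
    have hu0 : u ≠ 0 := by
      rintro rfl
      rw [Algebra.norm_zero] at hu
      exact div_ne_zero hB hA hu.symm
    refine Fintype.sum_equiv (Equiv.mulLeft₀ u hu0) _ _ fun s => ?_
    change _ = ψ (A * Algebra.norm (ZMod p) (u * s))
    rw [map_mul (Algebra.norm (ZMod p)), hu]
    congr 1
    field_simp
  have hsum : ∑ B : ZMod p, ∑ s : GaloisField p 2, ψ (B * Algebra.norm (ZMod p) s) = (p : Ω) := by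
    classical
    rw [Finset.sum_comm]
    have : ∀ s : GaloisField p 2, ∑ B : ZMod p, ψ (B * Algebra.norm (ZMod p) s)
        = if s = 0 then (p : Ω) else 0 := by
      intro s
      rw [AddChar.sum_mulShift _ (AddChar.IsPrimitive.of_ne_one hψ), ZMod.card]
      simp [Algebra.norm_eq_zero_iff]
    simp [this]
  rw [← Finset.add_sum_erase _ _ (Finset.mem_univ (0 : ZMod p)),
    Finset.sum_congr rfl fun B hB => hconst B (Finset.ne_of_mem_erase hB), Finset.sum_const,
    Finset.card_erase_of_mem (Finset.mem_univ _), Finset.card_univ, ZMod.card] at hsum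
  simp only [zero_mul, AddChar.map_zero_eq_one, Finset.sum_const, Finset.card_univ, hcard,
    nsmul_eq_mul, mul_one] at hsum
  rw [Nat.cast_sub hp.one_le] at hsum
  push_cast at hsum
  have h1 : (p : Ω) - 1 ≠ 0 := by
    rw [sub_ne_zero]
    exact_mod_cast hp.one_lt.ne'
  apply mul_left_cancel₀ h1
  linear_combination hsum

lemma sum_quad [CharZero Ω] [Fintype (GaloisField p 2)] {ψ : AddChar (ZMod p) Ω} (hψ : ψ ≠ 1)
    {A : ZMod p} (hA : A ≠ 0) (β : GaloisField p 2) :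
    ∑ s : GaloisField p 2, ψ (A * Algebra.norm (ZMod p) s
        - Algebra.trace (ZMod p) (GaloisField p 2) (β * s ^ p))
      = -(p : Ω) * ψ (-(Algebra.norm (ZMod p) β / A)) := by
  rw [← sum_psi_norm hψ hA, Finset.sum_mul]
  set a := algebraMap (ZMod p) (GaloisField p 2) A with ha
  have ha0 : a ≠ 0 := by simpa [ha] using hA
  refine Fintype.sum_equiv (Equiv.subRight (β / a)) _ _ fun s => ?_
  rw [← AddChar.map_add_eq_mul]
  congr 1
  apply (algebraMap (ZMod p) (GaloisField p 2)).injective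
  simp only [map_mul, map_add, map_neg, map_div₀, norm_eq, trace_eq, Equiv.subRight_apply,
    ← ha, sub_eq_add_neg, conj_add, mul_pow, conj_conj]
  have h1 : (-(β / a)) ^ p = -(β ^ p / a) := by
    rw [neg_div', div_pow, ha, conj_base, ← neg_div]
    congr 1
    have := conj_add β (-β)
    rw [add_neg_cancel, zero_pow (Fact.out : p.Prime).ne_zero] at this
    linear_combination -this
  rw [h1]
  field_simp
  ring

lemma sum_lin [Fintype (GaloisField p 2)] {ψ : AddChar (ZMod p) Ω} (hψ : ψ ≠ 1)
    (β : GaloisField p 2) [Decidable (β = 0)] :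
    ∑ s : GaloisField p 2, ψ (- Algebra.trace (ZMod p) (GaloisField p 2) (β * s ^ p))
      = if β = 0 then (p : Ω) ^ 2 else 0 := by
  have hcard : Fintype.card (GaloisField p 2) = p ^ 2 := by
    rw [← Nat.card_eq_fintype_card, GaloisField.card p 2 two_ne_zero]
  split_ifs with h
  · subst h
    simp [hcard]
  · obtain ⟨a, ha⟩ : ∃ a, ψ a ≠ 1 := by
      by_contra! h'
      exact hψ (by ext x; simp [h' x])
    obtain ⟨w, hw⟩ := Algebra.trace_surjective (ZMod p) (GaloisField p 2) (-a)
    set s₀ := (w / β) ^ p with hs₀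
    have hs₀' : β * s₀ ^ p = w := by rw [hs₀, conj_conj]; field_simp
    have key : ψ a * ∑ s : GaloisField p 2,
        ψ (- Algebra.trace (ZMod p) (GaloisField p 2) (β * s ^ p))
        = ∑ s : GaloisField p 2, ψ (- Algebra.trace (ZMod p) (GaloisField p 2) (β * s ^ p)) := by
      rw [Finset.mul_sum]
      refine Fintype.sum_equiv (Equiv.addRight s₀) _ _ fun s => ?_
      rw [← AddChar.map_add_eq_mul, Equiv.coe_addRight, conj_add, mul_add, hs₀',
        (Algebra.trace (ZMod p) (GaloisField p 2)).map_add, hw]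
      congr 1
      ring
    have h2 : (ψ a - 1) * ∑ s : GaloisField p 2,
        ψ (- Algebra.trace (ZMod p) (GaloisField p 2) (β * s ^ p)) = 0 := by
      rw [sub_mul, key, one_mul, sub_self]
    exact (mul_eq_zero.mp h2).resolve_left (sub_ne_zero.mpr ha)

lemma sum_reindex [Fintype (GaloisField p 2)] [DecidableEq (GaloisField p 2)]
    (f : ZMod p → GaloisField p 2 → GaloisField p 2 → Ω)
    (x z : (ZMod p)ˣ) {D D' : ZMod p} (hD : D ≠ 0) (hD' : D' ≠ 0) :
    ∑ y : (ZMod p)ˣ, ∑ t ∈ normFiber ((x : ZMod p) / (y : ZMod p) * D),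
        ∑ s ∈ normFiber ((y : ZMod p) / (z : ZMod p) * D'), f y t s
      = ∑ r ∈ normFiber ((x : ZMod p) / (z : ZMod p) * (D * D')),
        ∑ s ∈ Finset.univ.erase (0 : GaloisField p 2),
          f (z * Algebra.norm (ZMod p) s / D') (r / s) s := by
  have hx : (x : ZMod p) ≠ 0 := x.ne_zero
  have hz : (z : ZMod p) ≠ 0 := z.ne_zero
  simp_rw [Finset.sum_sigma']
  have hN : ∀ s : GaloisField p 2, s ≠ 0 → Algebra.norm (ZMod p) s ≠ 0 := fun s hs =>
    Algebra.norm_ne_zero_iff.mpr hs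
  refine Finset.sum_bij'
    (i := fun q _ => ⟨q.2.1 * q.2.2, q.2.2⟩)
    (j := fun q hq => ⟨Units.mk0 ((z : ZMod p) * Algebra.norm (ZMod p) q.2 / D')
      (div_ne_zero (mul_ne_zero hz (hN _ (by simpa using (Finset.mem_sigma.mp hq).2))) hD'),
      ⟨q.1 / q.2, q.2⟩⟩) ?_ ?_ ?_ ?_ ?_
  · rintro ⟨y, t, s⟩ h
    have hy : (y : ZMod p) ≠ 0 := y.ne_zero
    simp only [Finset.mem_sigma, Finset.mem_univ, true_and, mem_normFiber] at h
    simp only [Finset.mem_sigma, mem_normFiber, map_mul, h, Finset.mem_erase, Finset.mem_univ,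
      and_true]
    refine ⟨by field_simp, ?_⟩
    rintro rfl
    rw [Algebra.norm_zero] at h
    exact mul_ne_zero (div_ne_zero hy hz) hD' h.2.symm
  · rintro ⟨r, s⟩ h
    simp only [Finset.mem_sigma, Finset.mem_erase, Finset.mem_univ, and_true, mem_normFiber] at h
    have := hN _ h.2
    have hdiv : Algebra.norm (ZMod p) (r / s)
        = (x : ZMod p) / (z : ZMod p) * (D * D') / Algebra.norm (ZMod p) s := by
      rw [eq_div_iff this, ← map_mul, div_mul_cancel₀ _ h.2, h.1]
    simp only [Finset.mem_sigma, Finset.mem_univ, true_and, mem_normFiber, hdiv,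
      Units.val_mk0]
    constructor <;> field_simp
  · rintro ⟨y, t, s⟩ h
    have hy : (y : ZMod p) ≠ 0 := y.ne_zero
    simp only [Finset.mem_sigma, Finset.mem_univ, true_and, mem_normFiber] at h
    have hs : s ≠ 0 := by
      rintro rfl
      rw [Algebra.norm_zero] at h
      exact mul_ne_zero (div_ne_zero hy hz) hD' h.2.symm
    have e1 : (z : ZMod p) * Algebra.norm (ZMod p) s / D' = y := by rw [h.2]; field_simp
    have e2 : t * s / s = t := by field_simp
    simp only [e1, e2, Units.mk0_val]
  · rintro ⟨r, s⟩ h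
    simp only [Finset.mem_sigma, Finset.mem_erase, Finset.mem_univ, and_true, mem_normFiber] at h
    have := h.2
    simp only [div_mul_cancel₀ _ this]
  · rintro ⟨y, t, s⟩ h
    have hy : (y : ZMod p) ≠ 0 := y.ne_zero
    simp only [Finset.mem_sigma, Finset.mem_univ, true_and, mem_normFiber] at h
    have hs : s ≠ 0 := by
      rintro rfl
      rw [Algebra.norm_zero] at h
      exact mul_ne_zero (div_ne_zero hy hz) hD' h.2.symm
    have e1 : (z : ZMod p) * Algebra.norm (ZMod p) s / D' = y := by rw [h.2]; field_simp
    have e2 : t * s / s = t := by field_simp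
    simp only [e1, e2]
lemma kernel_mul_generic [CharZero Ω] [Fintype (GaloisField p 2)]
    {χ : MulChar (GaloisField p 2) Ω} (hχ : χ ^ p ≠ χ) (ψ : AddChar (ZMod p) Ω)
    (g h : GL (Fin 2) (ZMod p)) (hg : g 1 0 ≠ 0) (hh : h 1 0 ≠ 0) (x z : (ZMod p)ˣ) :
    ∑ y, kirillovKernel χ ψ g x y * kirillovKernel χ ψ h y z =
      ((p : Ω) ^ 2)⁻¹ * ψ (g 0 0 * (x : ZMod p) / g 1 0 + h 1 1 * (z : ZMod p) / h 1 0) *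
        ∑ r ∈ normFiber ((x : ZMod p) / (z : ZMod p) * (g.val.det * h.val.det)), χ r *
          ∑ s : GaloisField p 2, ψ ((z : ZMod p) * (g 1 0 * h 0 0 + g 1 1 * h 1 0)
                / (g 1 0 * h 1 0 * h.val.det) * Algebra.norm (ZMod p) s
            - Algebra.trace (ZMod p) (GaloisField p 2)
              (algebraMap (ZMod p) (GaloisField p 2) z * (r / algebraMap (ZMod p) (GaloisField p 2)
                (h.val.det * g 1 0) + (algebraMap (ZMod p) (GaloisField p 2) (h 1 0))⁻¹)
                * s ^ p)) := by
  classical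
  have hx : (x : ZMod p) ≠ 0 := x.ne_zero
  have hz : (z : ZMod p) ≠ 0 := z.ne_zero
  have hD : g.val.det ≠ 0 := g.det.ne_zero
  have hD' : h.val.det ≠ 0 := h.det.ne_zero
  let f : ZMod p → GaloisField p 2 → GaloisField p 2 → Ω := fun (y : ZMod p) (t s : GaloisField p 2) => ((p : Ω) ^ 2)⁻¹ *
            ψ ((g 0 0 * (x : ZMod p) + g 1 1 * y) / g 1 0
              + (h 0 0 * y + h 1 1 * (z : ZMod p)) / h 1 0
              + -(y / g 1 0) * Algebra.trace (ZMod p) (GaloisField p 2) t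
              + -((z : ZMod p) / h 1 0) * Algebra.trace (ZMod p) (GaloisField p 2) s)
            * χ (t * s)
  have step1 : ∑ y, kirillovKernel χ ψ g x y * kirillovKernel χ ψ h y z =
      ∑ y : (ZMod p)ˣ, ∑ t ∈ normFiber ((x : ZMod p) / (y : ZMod p) * g.val.det),
        ∑ s ∈ normFiber ((y : ZMod p) / (z : ZMod p) * h.val.det),
          f y t s := by
    refine Finset.sum_congr rfl fun y _ => ?_
    simp only [kirillovKernel, if_neg hg, if_neg hh]
    rw [mul_mul_mul_comm, Finset.sum_mul_sum, Finset.mul_sum]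
    refine Finset.sum_congr rfl fun t _ => ?_
    rw [Finset.mul_sum]
    refine Finset.sum_congr rfl fun s _ => ?_
    simp only [f]
    rw [AddChar.map_add_eq_mul, AddChar.map_add_eq_mul, AddChar.map_add_eq_mul, map_mul χ]
    ring
  rw [step1, sum_reindex f x z hD hD', Finset.mul_sum]
  have hzero : ∑ r ∈ normFiber ((x : ZMod p) / (z : ZMod p) * (g.val.det * h.val.det)),
      ((p : Ω) ^ 2)⁻¹ * ψ (g 0 0 * (x : ZMod p) / g 1 0 + h 1 1 * (z : ZMod p) / h 1 0) * χ r
        = 0 := by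
    rw [← Finset.mul_sum, sum_normFiber_eq_zero hχ _
      (mul_ne_zero (div_ne_zero hx hz) (mul_ne_zero hD hD')), mul_zero]
  rw [← add_zero (∑ r ∈ _, ∑ s ∈ _, _), ← hzero, ← Finset.sum_add_distrib]
  refine Finset.sum_congr rfl fun r _ => ?_
  rw [← Finset.sum_erase_add _ _ (Finset.mem_univ (0 : GaloisField p 2))]
  have hp0 : p ≠ 0 := (Fact.out : p.Prime).ne_zero
  have h0 : ψ ((z : ZMod p) * (g 1 0 * h 0 0 + g 1 1 * h 1 0)
                / (g 1 0 * h 1 0 * h.val.det) * Algebra.norm (ZMod p) (0 : GaloisField p 2)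
            - Algebra.trace (ZMod p) (GaloisField p 2)
              (algebraMap (ZMod p) (GaloisField p 2) z * (r / algebraMap (ZMod p) (GaloisField p 2)
                (h.val.det * g 1 0) + (algebraMap (ZMod p) (GaloisField p 2) (h 1 0))⁻¹)
                * 0 ^ p)) = 1 := by
    rw [Algebra.norm_zero, zero_pow hp0, mul_zero, mul_zero, map_zero, sub_zero,
      AddChar.map_zero_eq_one]
  rw [h0, mul_add, mul_add, mul_one]
  congr 1
  rw [Finset.mul_sum, Finset.mul_sum]
  refine Finset.sum_congr rfl fun s hs => ?_
  have hs0 : s ≠ 0 := Finset.ne_of_mem_erase hs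
  simp only [f]
  rw [div_mul_cancel₀ _ hs0]
  rw [show ∀ a b c d : Ω, a * b * (c * d) = a * (b * d) * c from fun a b c d => by ring,
    ← AddChar.map_add_eq_mul]
  congr 3
  apply (algebraMap (ZMod p) (GaloisField p 2)).injective
  have i1 : algebraMap (ZMod p) (GaloisField p 2) (g 1 0) ≠ 0 := by simpa using hg
  have i2 : algebraMap (ZMod p) (GaloisField p 2) (h 1 0) ≠ 0 := by simpa using hh
  have i3 : algebraMap (ZMod p) (GaloisField p 2) h.val.det ≠ 0 := by simpa using hD'
  have i4 : s ^ p ≠ 0 := pow_ne_zero _ hs0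
  simp only [map_sub, map_mul, map_add, map_neg, map_div₀, norm_eq, trace_eq, conj_add, mul_pow,
    div_pow, inv_pow, conj_base, conj_conj]
  field_simp
  ring
lemma normFiber_smul_sum (χ : MulChar (GaloisField p 2) Ω) (ψ : AddChar (ZMod p) Ω)
    {d : ZMod p} (hd : d ≠ 0) (n m : ZMod p) (e f : ZMod p) (hm : m = d ^ 2 * n)
    (hf : e = f * d) :
    χ (algebraMap (ZMod p) (GaloisField p 2) d) *
      ∑ t ∈ normFiber n, ψ (e * Algebra.trace (ZMod p) (GaloisField p 2) t) * χ t =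
    ∑ t ∈ normFiber m, ψ (f * Algebra.trace (ZMod p) (GaloisField p 2) t) * χ t := by
  have hd' : algebraMap (ZMod p) (GaloisField p 2) d ≠ 0 := by simpa using hd
  have hN : Algebra.norm (ZMod p) (algebraMap (ZMod p) (GaloisField p 2) d) = d ^ 2 := by
    rw [Algebra.norm_algebraMap, GaloisField.finrank p two_ne_zero]
  rw [Finset.mul_sum]
  refine Finset.sum_nbij' (fun t => algebraMap (ZMod p) (GaloisField p 2) d * t)
    (fun t => (algebraMap (ZMod p) (GaloisField p 2) d)⁻¹ * t) ?_ ?_ ?_ ?_ ?_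
  · intro t ht
    rw [mem_normFiber] at ht ⊢
    rw [map_mul, hN, ht, hm]
  · intro t ht
    rw [mem_normFiber] at ht ⊢
    apply mul_left_cancel₀ (pow_ne_zero 2 hd)
    rw [← hm, ← hN, ← map_mul, mul_inv_cancel_left₀ hd', ht]
  · intro t _
    exact inv_mul_cancel_left₀ hd' t
  · intro t _
    exact mul_inv_cancel_left₀ hd' t
  · intro t _
    rw [map_mul χ, ← Algebra.smul_def, map_smul, smul_eq_mul, hf]
    ring_nf

lemma kernel_mul [CharZero Ω] {χ : MulChar (GaloisField p 2) Ω} (hχ : χ ^ p ≠ χ)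
    {ψ : AddChar (ZMod p) Ω} (hψ : ψ ≠ 1) (g h : GL (Fin 2) (ZMod p)) :
    kirillovKernel χ ψ (g * h) = kirillovKernel χ ψ g * kirillovKernel χ ψ h := by
  classical
  have : Fintype (GaloisField p 2) := Fintype.ofFinite _
  ext x z
  rw [Matrix.mul_apply]
  have hx : (x : ZMod p) ≠ 0 := x.ne_zero
  have hz : (z : ZMod p) ≠ 0 := z.ne_zero
  have hD : g.val.det ≠ 0 := g.det.ne_zero
  have hD' : h.val.det ≠ 0 := h.det.ne_zero
  have e00 : (g * h) 0 0 = g 0 0 * h 0 0 + g 0 1 * h 1 0 := by simp [Matrix.mul_apply]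
  have e01 : (g * h) 0 1 = g 0 0 * h 0 1 + g 0 1 * h 1 1 := by simp [Matrix.mul_apply]
  have e10 : (g * h) 1 0 = g 1 0 * h 0 0 + g 1 1 * h 1 0 := by simp [Matrix.mul_apply]
  have e11 : (g * h) 1 1 = g 1 0 * h 0 1 + g 1 1 * h 1 1 := by simp [Matrix.mul_apply]
  have edet : (g * h).val.det = g.val.det * h.val.det := by simp
  have dg : g.val.det = g 0 0 * g 1 1 - g 0 1 * g 1 0 := Matrix.det_fin_two _
  have dh : h.val.det = h 0 0 * h 1 1 - h 0 1 * h 1 0 := Matrix.det_fin_two _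
  have key := kernel_mul_generic hχ ψ g h
  rw [kirillovKernel, e00, e01, e10, e11, edet]
  unfold kirillovKernel at key ⊢
  generalize g 0 0 = a at *
  generalize g 0 1 = b at *
  generalize g 1 0 = c at *
  generalize g 1 1 = d at *
  generalize h 0 0 = a' at *
  generalize h 0 1 = b' at *
  generalize h 1 0 = c' at *
  generalize h 1 1 = d' at *
  generalize g.val.det = D at *
  generalize h.val.det = D' at *
  clear e00 e01 e10 e11 edet g h
  by_cases hc : c = 0
  · subst hc
    have ha : a ≠ 0 := by rintro rfl; simp [dg] at hD
    have hd : d ≠ 0 := by rintro rfl; simp [dg] at hD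
    obtain ⟨y₀, hy₀⟩ : ∃ y₀ : (ZMod p)ˣ, (y₀ : ZMod p) = a * x / d :=
      ⟨Units.mk0 _ (div_ne_zero (mul_ne_zero ha hx) hd), rfl⟩
    rw [Finset.sum_eq_single y₀]
    rotate_left
    · intro y _ hy
      rw [if_pos rfl, if_neg, zero_mul]
      intro h'
      apply hy
      ext
      rw [hy₀, h']
      field_simp
    · simp
    simp only [if_true, zero_mul, zero_add]
    rw [if_pos (show a * (x : ZMod p) = d * y₀ by rw [hy₀]; field_simp)]
    by_cases hc' : c' = 0
    · subst hc'
      have hd' : d' ≠ 0 := by rintro rfl; simp [dh] at hD'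
      simp only [mul_zero, if_true, add_zero]
      by_cases h1 : a * a' * (x : ZMod p) = d * d' * z
      · rw [if_pos h1, if_pos (show a' * (y₀ : ZMod p) = d' * z by
          rw [hy₀]; field_simp; linear_combination h1)]
        rw [map_mul, map_mul χ, mul_mul_mul_comm, ← AddChar.map_add_eq_mul, hy₀]
        congr 2
        field_simp
        ring
      · rw [if_neg h1, if_neg, mul_zero]
        intro h2
        apply h1
        rw [hy₀] at h2
        field_simp at h2
        linear_combination h2
    · rw [if_neg (mul_ne_zero hd hc'), if_neg hc', hy₀]
      rw [← normFiber_smul_sum χ ψ hd (a * x / d / z * D') (x / z * (D * D'))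
        (-(z / c')) (-(z / (d * c'))) (by rw [dg]; field_simp; ring) (by field_simp)]
      rw [show ((a * a' + b * c') * (x : ZMod p) + d * d' * z) / (d * c')
        = b * x / d + (a' * (a * x / d) + d' * z) / c' by field_simp; ring,
        AddChar.map_add_eq_mul]
      ring
  · by_cases hc' : c' = 0
    · subst hc'
      have ha' : a' ≠ 0 := by rintro rfl; simp [dh] at hD'
      have hd' : d' ≠ 0 := by rintro rfl; simp [dh] at hD'
      obtain ⟨y₀, hy₀⟩ : ∃ y₀ : (ZMod p)ˣ, (y₀ : ZMod p) = d' * z / a' :=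
        ⟨Units.mk0 _ (div_ne_zero (mul_ne_zero hd' hz) ha'), rfl⟩
      rw [Finset.sum_eq_single y₀]
      rotate_left
      · intro y _ hy
        have hne : ¬ a' * (y : ZMod p) = d' * z := fun h' => hy <| by
          ext
          rw [hy₀, ← h']
          field_simp
        rw [if_pos (rfl : (0 : ZMod p) = 0), if_neg hne, mul_zero]
      · simp
      simp only [if_true, mul_zero, add_zero, if_neg hc, if_neg (mul_ne_zero hc ha')]
      rw [if_pos (show a' * (y₀ : ZMod p) = d' * z by rw [hy₀]; field_simp), hy₀]
      rw [← normFiber_smul_sum χ ψ hd' (x / (d' * z / a') * D) (x / z * (D * D'))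
        (-(d' * z / a' / c)) (-(z / (c * a'))) (by rw [dh]; field_simp; ring) (by field_simp)]
      rw [show (a * a' * (x : ZMod p) + (c * b' + d * d') * z) / (c * a')
        = (a * x + d * (d' * z / a')) / c + b' * (d' * z / a') / d' by field_simp; ring,
        AddChar.map_add_eq_mul]
      ring
    · rw [key hc hc']
      have hp : (p : Ω) ≠ 0 := by exact_mod_cast (Fact.out : p.Prime).ne_zero
      have i1 : algebraMap (ZMod p) (GaloisField p 2) c ≠ 0 := by simpa using hc
      have i2 : algebraMap (ZMod p) (GaloisField p 2) c' ≠ 0 := by simpa using hc'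
      have i3 : algebraMap (ZMod p) (GaloisField p 2) D' ≠ 0 := by simpa using hD'
      have i4 : algebraMap (ZMod p) (GaloisField p 2) z ≠ 0 := by simp
      by_cases h0 : c * a' + d * c' = 0
      · rw [if_pos h0, h0]
        simp only [mul_zero, zero_div, zero_mul, zero_sub, sum_lin hψ]
        have hr : ∀ r : GaloisField p 2, algebraMap (ZMod p) (GaloisField p 2) z *
            (r / algebraMap (ZMod p) (GaloisField p 2) (D' * c) +
              (algebraMap (ZMod p) (GaloisField p 2) c')⁻¹) = 0 ↔
            r = algebraMap (ZMod p) (GaloisField p 2) (c * b' + d * d') := by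
          intro r
          have hd'' : c * b' + d * d' = - (c * D' / c') := by
            field_simp
            rw [dh]
            linear_combination d' * h0
          rw [hd'', mul_eq_zero, or_iff_right i4]
          simp only [map_neg, map_div₀, map_mul]
          constructor
          · intro h1
            field_simp at h1 ⊢
            linear_combination h1
          · rintro rfl
            field_simp
            ring
        simp only [hr, mul_ite, mul_zero, Finset.sum_ite_eq', mem_normFiber,
          Algebra.norm_algebraMap, GaloisField.finrank p two_ne_zero]
        have hcd : c * (a * a' + b * c') = -(c' * D) := by
          rw [dg]; linear_combination a * h0
        have hcd' : c' * (c * b' + d * d') = -(c * D') := by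
          rw [dh]; linear_combination d' * h0
        have hd''0 : c * b' + d * d' ≠ 0 := by
          intro h1
          rw [h1, mul_zero, zero_eq_neg] at hcd'
          exact mul_ne_zero hc hD' hcd'
        have hDD : (a * a' + b * c') * (c * b' + d * d') = D * D' := by
          apply mul_left_cancel₀ (mul_ne_zero hc hc')
          linear_combination hcd * (c' * (c * b' + d * d')) - c' * D * hcd'
        have hiff : (c * b' + d * d') ^ 2 = (x : ZMod p) / z * (D * D') ↔
            (a * a' + b * c') * (x : ZMod p) = (c * b' + d * d') * z := by
          rw [← hDD]
          constructor
          · intro h1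
            field_simp at h1
            linear_combination -h1
          · intro h1
            field_simp
            linear_combination -h1
        by_cases h1 : (a * a' + b * c') * (x : ZMod p) = (c * b' + d * d') * z
        · rw [if_pos h1, if_pos (hiff.mpr h1)]
          have harg : (a * b' + b * d') * (x : ZMod p) / (c * b' + d * d')
              = a * x / c + d' * z / c' := by
            have hb : c * c' * (a * b' + b * d') = -(a * c * D') - d' * c' * D := by
              rw [dg, dh]; linear_combination a * d' * h0
            rw [div_add_div _ _ hc hc', div_eq_div_iff hd''0 (mul_ne_zero hc hc')]
            linear_combination x * hb - a * x * hcd' + d' * c * h1 - d' * x * hcd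
          rw [harg]
          field_simp
        · rw [if_neg h1, if_neg (fun h2 => h1 (hiff.mp h2))]
      · rw [if_neg h0]
        have hA : (z : ZMod p) * (c * a' + d * c') / (c * c' * D') ≠ 0 :=
          div_ne_zero (mul_ne_zero hz h0) (mul_ne_zero (mul_ne_zero hc hc') hD')
        simp only [sum_quad hψ hA]
        rw [Finset.mul_sum, Finset.mul_sum]
        refine Finset.sum_congr rfl fun r hr => ?_
        rw [mem_normFiber] at hr
        have i5 : algebraMap (ZMod p) (GaloisField p 2) (c * a' + d * c') ≠ 0 :=
          (map_ne_zero _).mpr h0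
        have hr' : r * r ^ p = algebraMap (ZMod p) (GaloisField p 2) (x / z * (D * D')) := by
          rw [← hr, norm_eq]
        have harg : ((a * a' + b * c') * (x : ZMod p) + (c * b' + d * d') * z) / (c * a' + d * c')
              + -(z / (c * a' + d * c')) * Algebra.trace (ZMod p) (GaloisField p 2) r
            = a * x / c + d' * z / c' + -(Algebra.norm (ZMod p)
                (algebraMap (ZMod p) (GaloisField p 2) z *
                  (r / algebraMap (ZMod p) (GaloisField p 2) (D' * c) +
                  (algebraMap (ZMod p) (GaloisField p 2) c')⁻¹))
                / ((z : ZMod p) * (c * a' + d * c') / (c * c' * D'))) := by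
          have hN : Algebra.norm (ZMod p)
                (algebraMap (ZMod p) (GaloisField p 2) z *
                  (r / algebraMap (ZMod p) (GaloisField p 2) (D' * c) +
                  (algebraMap (ZMod p) (GaloisField p 2) c')⁻¹))
              = (z : ZMod p) ^ 2 * (x / z * (D * D') / (D' * c) ^ 2
                + Algebra.trace (ZMod p) (GaloisField p 2) r / (D' * c * c') + 1 / c' ^ 2) := by
            apply (algebraMap (ZMod p) (GaloisField p 2)).injective
            rw [map_mul _ ((z : ZMod p) ^ 2), map_add, map_add,
              map_div₀ _ ((x : ZMod p) / z * (D * D')), ← hr']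
            simp only [map_mul, map_div₀, map_pow, map_one, norm_eq, trace_eq, conj_add,
              mul_pow, div_pow, inv_pow, conj_base]
            field_simp
            ring
          rw [hN]
          generalize Algebra.trace (ZMod p) (GaloisField p 2) r = T
          have hq : (z : ZMod p) ^ 2 * (x / z * (D * D') / (D' * c) ^ 2
                + T / (D' * c * c') + 1 / c' ^ 2) / ((z : ZMod p) * (c * a' + d * c') / (c * c' * D'))
              = (x * D * c' / c + z * T + z * c * D' / c') / (c * a' + d * c') := by
            field_simp
          rw [hq, dg, dh]
          obtain ⟨C, hC⟩ : ∃ C, C = c * a' + d * c' := ⟨_, rfl⟩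
          rw [← hC] at h0 ⊢
          field_simp
          rw [hC]
          ring
        have hmul := congrArg ψ harg
        rw [AddChar.map_add_eq_mul, AddChar.map_add_eq_mul] at hmul
        have hp2 : ((p : Ω) ^ 2)⁻¹ * p = (p : Ω)⁻¹ := by field_simp
        linear_combination (-(p : Ω)⁻¹ * χ r) * hmul + χ r * (ψ (a * x / c + d' * z / c')) *
          ψ (-(Algebra.norm (ZMod p) (algebraMap (ZMod p) (GaloisField p 2) z *
            (r / algebraMap (ZMod p) (GaloisField p 2) (D' * c) +
              (algebraMap (ZMod p) (GaloisField p 2) c')⁻¹))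
            / ((z : ZMod p) * (c * a' + d * c') / (c * c' * D')))) * hp2

lemma kernel_one (χ : MulChar (GaloisField p 2) Ω) (ψ : AddChar (ZMod p) Ω) :
    kirillovKernel χ ψ (1 : GL (Fin 2) (ZMod p)) = 1 := by
  ext x y
  simp [kirillovKernel, Matrix.one_apply, Units.ext_iff]
/-- The cuspidal representation `Ds(χ)` of `GL₂(𝔽_p)` attached to a character `χ` of `𝔽_{p²}ˣ` with
`χ ^ p ≠ χ`, in its Kirillov model with respect to a nontrivial additive character `ψ` of `𝔽_p`.
It has dimension `p - 1` and central character `χ|_{𝔽_pˣ}`, its trace at an element with eigenvalues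
`t, t ^ p` in `𝔽_{p²} ∖ 𝔽_p` is `-(χ(t) + χ(t ^ p))`, and its isomorphism class does not depend
on `ψ`. -/
def cuspidalRep [CharZero Ω] (χ : MulChar (GaloisField p 2) Ω) (hχ : χ ^ p ≠ χ)
    (ψ : AddChar (ZMod p) Ω) (hψ : ψ ≠ 1) :
    Representation Ω (GL (Fin 2) (ZMod p)) ((ZMod p)ˣ → Ω) where
  toFun g := Matrix.toLin' (kirillovKernel χ ψ g)
  map_one' := by rw [kernel_one, Matrix.toLin'_one]; rfl
  map_mul' g h := by rw [kernel_mul hχ hψ, Matrix.toLin'_mul]; rfl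

end Kirillov

section Teichmuller

variable {p : ℕ} [Fact p.Prime] {O Ω : Type*} [CommRing O] [Field Ω] [Algebra O Ω]

/-- The character `x ↦ [x]` of `𝔽_{p²}ˣ` with values in `Ω`: the Teichmüller lift to the Witt ring,
followed by an embedding of the Witt ring into the ring of integers of `Ω` over `O`. -/
def teichmullerChar (j : WittVector p (GaloisField p 2) →+* integralClosure O Ω) :
    MulChar (GaloisField p 2) Ω where
  toFun x := (j (WittVector.teichmuller p x) : Ω)
  map_one' := by simp
  map_mul' x y := by simp
  map_nonunit' x hx := by
    have hx0 : x = 0 := by simpa using hx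
    simp [hx0, WittVector.teichmuller_zero]

/-- The character `χ(x) = x ^ a x̄ ^ b`, where `x` stands for its Teichmüller lift and `x̄ = x ^ p`. -/
def chiChar (j : WittVector p (GaloisField p 2) →+* integralClosure O Ω) (a b : ℤ) :
    MulChar (GaloisField p 2) Ω :=
  teichmullerChar j ^ a * (teichmullerChar j ^ p) ^ b

end Teichmuller

section Reduction

variable {G : Type*} [Group G]

/-- Extension of scalars of a representation. -/
def baseChangeRep {R : Type*} (S : Type*) [CommRing R] [CommRing S] [Algebra R S] {M : Type*}
    [AddCommGroup M] [Module R M] (ρ : Representation R G M) :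
    Representation S G (TensorProduct R S M) where
  toFun g := (ρ g).baseChange S
  map_one' := by rw [map_one]; exact LinearMap.baseChange_id
  map_mul' g h := by rw [map_mul]; exact LinearMap.baseChange_comp _ _

variable {O E V : Type*} [CommRing O] [Field E] [Algebra O E] [AddCommGroup V] [Module E V]
  [Module O V] [IsScalarTower O E V]

/-- The action of `G` on a `G`-stable lattice `L`. -/
def latticeRep (ρ : Representation E G V) (L : Submodule O V) (hL : ∀ g, ∀ v ∈ L, ρ g v ∈ L) :
    Representation O G L where
  toFun g :=
    { toFun := fun v => ⟨ρ g v, hL g v v.2⟩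
      map_add' := fun v w => Subtype.ext (map_add (ρ g) (v : V) w)
      map_smul' := fun c v => Subtype.ext (((ρ g).restrictScalars O).map_smul c (v : V)) }
  map_one' := by ext v; simp
  map_mul' g h := by ext v; simp

/-- The reduction of `ρ` with respect to the `G`-stable lattice `L`: the representation on
`L / 𝔪 L = k ⊗ L` over the residue field `k = O / 𝔪`. -/
def reductionRep [IsLocalRing O] (ρ : Representation E G V) (L : Submodule O V)
    (hL : ∀ g, ∀ v ∈ L, ρ g v ∈ L) :
    Representation (IsLocalRing.ResidueField O) G
      (TensorProduct O (IsLocalRing.ResidueField O) L) :=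
  baseChangeRep (IsLocalRing.ResidueField O) (latticeRep ρ L hL)

/-- The Jordan–Hölder factors of `σ`, with multiplicity and up to isomorphism and order, are the
nonzero members of the family `X` (zero representations in the family are disregarded). -/
def HasJordanHolderFactors {k : Type*} [Field k] {M : Type*} [AddCommGroup M] [Module k M]
    (σ : Representation k G M) {ι : Type*} (X : ι → Rep k G) : Prop :=
  ∃ s : CompositionSeries (Submodule (MonoidAlgebra k G) σ.asModule),
    s.head = ⊥ ∧ s.last = ⊤ ∧
    ∃ e : Fin s.length ≃ {i : ι // Nontrivial (X i)}, ∀ m : Fin s.length,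
      Nonempty ((s m.succ ⧸ (s m.castSucc).submoduleOf (s m.succ))
        ≃ₗ[MonoidAlgebra k G] (X (e m)).ρ.asModule)

end Reduction

section SymmetricPower

variable (p : ℕ) [Fact p.Prime] (k : Type*) [Field k] [CharP k p]

/-- The action of `g` on the symmetric algebra of `V = k²`, with the basis vectors of `V` written as
the variables: `g e_j = ∑ i, g_{ij} e_i`. -/
def symSubst (g : GL (Fin 2) (ZMod p)) : MvPolynomial (Fin 2) k →ₐ[k] MvPolynomial (Fin 2) k :=
  MvPolynomial.aeval fun j =>
    ∑ i, MvPolynomial.C (ZMod.castHom (dvd_refl p) k (g i j)) * MvPolynomial.X i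

/-- The underlying space of `Sym^n V`: forms of degree `n` in `e_0, e_1`, and `0` if `n < 0`. -/
def symSpace (n : ℤ) : Submodule k (MvPolynomial (Fin 2) k) :=
  if 0 ≤ n then MvPolynomial.homogeneousSubmodule (Fin 2) k n.toNat else ⊥

lemma symSubst_mem (n : ℤ) (g : GL (Fin 2) (ZMod p)) (f : MvPolynomial (Fin 2) k)
    (hf : f ∈ symSpace k n) : (symSubst p k g).toLinearMap f ∈ symSpace k n := by
  rw [AlgHom.toLinearMap_apply]
  unfold symSpace at *
  split_ifs at * with h
  · rw [MvPolynomial.mem_homogeneousSubmodule] at *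
    have := MvPolynomial.IsHomogeneous.aeval (n := 1) hf (fun j =>
      ∑ i, MvPolynomial.C (ZMod.castHom (dvd_refl p) k (g i j)) * MvPolynomial.X i) (fun j =>
        MvPolynomial.IsHomogeneous.sum _ _ _ fun i _ => by
          simpa using (MvPolynomial.isHomogeneous_C (Fin 2) _).mul (MvPolynomial.isHomogeneous_X k i))
    simpa [symSubst] using this
  · simp at hf ⊢
    simp [hf]

lemma symSubst_one : symSubst p k 1 = AlgHom.id k _ := by
  ext j : 1
  simp [symSubst, Matrix.one_apply]

lemma symSubst_mul (g h : GL (Fin 2) (ZMod p)) :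
    symSubst p k (g * h) = (symSubst p k g).comp (symSubst p k h) := by
  ext j : 1
  simp [symSubst, Matrix.mul_apply]
  ring

/-- The representation `Sym^n V`. -/
def symRep (n : ℤ) : Representation k (GL (Fin 2) (ZMod p)) (symSpace k n) where
  toFun g := (symSubst p k g).toLinearMap.restrict (symSubst_mem p k n g)
  map_one' := by
    ext f : 2
    rw [LinearMap.coe_restrict_apply, symSubst_one]
    rfl
  map_mul' g h := by
    ext f : 2
    rw [LinearMap.coe_restrict_apply, symSubst_mul, Module.End.mul_apply,
      LinearMap.coe_restrict_apply, LinearMap.coe_restrict_apply]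
    rfl

/-- The character `det ^ m`. -/
def detPow (m : ℤ) : GL (Fin 2) (ZMod p) →* k where
  toFun g := ZMod.castHom (dvd_refl p) k
    ((Matrix.GeneralLinearGroup.det g ^ m : (ZMod p)ˣ) : ZMod p)
  map_one' := by rw [map_one, one_zpow, Units.val_one, map_one]
  map_mul' g h := by rw [map_mul, mul_zpow, Units.val_mul, map_mul]

/-- The representation `det ^ m ⊗ Sym^n V`, on the space of `Sym^n V`. -/
def detSymRep (m n : ℤ) : Representation k (GL (Fin 2) (ZMod p)) (symSpace k n) where
  toFun g := detPow p k m g • symRep p k n g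
  map_one' := by rw [map_one, map_one, one_smul]
  map_mul' g h := by rw [map_mul, map_mul, smul_mul_smul_comm]

end SymmetricPower

end CuspidalGL2

end

noncomputable section

namespace CuspidalGL2

section BrauerNesbitt

universe u v

open Module

section Density

variable {A : Type*} [Ring A]

/-- Given finite subsets of finitely many simple modules and a set of isomorphism classes, some
element of the ring acts on these subsets as the identity or as zero, according to the class. -/
lemma exists_smul_eq_ite {κ : Type*} [Finite κ] (Z : κ → ModuleCat.{u} A)
    [∀ q, IsSimpleModule A (Z q)] (c : κ → Prop) [DecidablePred c]
    (hc : ∀ q q', Nonempty (Z q ≃ₗ[A] Z q') → c q → c q') (s : ∀ q, Finset (Z q)) :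
    ∃ x : A, ∀ q, ∀ z ∈ s q, x • z = if c q then z else 0 := by
  classical
  have := Fintype.ofFinite κ
  have hpure : ∀ (φ : Module.End A (∀ q, Z q)) (q q' : κ) (z : Z q), ¬ (c q ↔ c q') →
      φ (Pi.single q z) q' = 0 := by
    intro φ q q' z h
    let f : Z q →ₗ[A] Z q' := LinearMap.proj q' ∘ₗ φ ∘ₗ LinearMap.single A (fun q => Z q) q
    have hf : f = 0 := by
      refine (LinearMap.bijective_or_eq_zero f).resolve_left fun hb => h ?_
      let e := LinearEquiv.ofBijective f hb
      exact ⟨hc q q' ⟨e⟩, hc q' q ⟨e.symm⟩⟩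
    exact LinearMap.congr_fun hf z
  let e : (∀ q, Z q) →+ (∀ q, Z q) :=
    { toFun := fun z q => if c q then z q else 0
      map_zero' := by ext q; simp
      map_add' := fun z w => by ext q; by_cases h : c q <;> simp [h] }
  have hcomm : ∀ (φ : Module.End A (∀ q, Z q)) (z : ∀ q, Z q), e (φ z) = φ (e z) := by
    intro φ z
    rw [← Finset.univ_sum_single z]
    simp only [map_sum]
    refine Finset.sum_congr rfl fun q _ => ?_
    have he : e (Pi.single q (z q)) = if c q then Pi.single q (z q) else 0 := by
      ext q'
      by_cases hq : q' = q
      · subst hq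
        by_cases h : c q' <;> simp [e, h]
      · by_cases h : c q' <;> by_cases h' : c q <;> simp [e, h, h', hq]
    rw [he]
    ext q'
    by_cases h : c q <;> by_cases h' : c q' <;> simp only [e, h, h', AddMonoidHom.coe_mk,
      ZeroHom.coe_mk, if_true, if_false, map_zero, Pi.zero_apply]
    · exact (hpure φ q q' (z q) (by simp [h, h'])).symm
    · exact hpure φ q q' (z q) (by simp [h, h'])
  let f : Module.End (Module.End A (∀ q, Z q)) (∀ q, Z q) :=
    { toFun := e, map_add' := e.map_add, map_smul' := fun φ z => hcomm φ z }
  obtain ⟨x, hx⟩ := jacobson_density (R := A) f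
    (Finset.univ.biUnion fun q => (s q).image fun z => (Pi.single q z : ∀ q, Z q))
  refine ⟨x, fun q z hz => ?_⟩
  have := congrFun (hx (Pi.single q z) (Finset.mem_biUnion.mpr
    ⟨q, Finset.mem_univ q, Finset.mem_image_of_mem _ hz⟩)) q
  have hf : f (Pi.single q z) q = if c q then z else 0 := by
    change (if c q then (Pi.single q z : ∀ q, Z q) q else 0) = _
    simp
  rw [hf, Pi.smul_apply, Pi.single_eq_same] at this
  exact this.symm

end Density

variable {k : Type*} [Field k] {A : Type*} [Ring A] [Algebra k A]

variable (k) in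
/-- The trace of the action of `x ∈ A` on `M`, as a `k`-linear map. -/
def actionTrace (M : Type*) [AddCommGroup M] [Module k M] [Module A M] [IsScalarTower k A M]
    (x : A) : k :=
  LinearMap.trace k M (Algebra.lsmul k k M x)

lemma actionTrace_congr {M N : Type*} [AddCommGroup M] [Module k M] [Module A M]
    [IsScalarTower k A M] [AddCommGroup N] [Module k N] [Module A N] [IsScalarTower k A N]
    (e : M ≃ₗ[A] N) (x : A) : actionTrace k M x = actionTrace k N x := by
  unfold actionTrace
  rw [← LinearMap.trace_conj' _ (e.restrictScalars k)]
  congr 1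
  ext n
  simp [LinearEquiv.conj_apply]

/-- The trace of an endomorphism is the sum of the traces on an invariant subspace and on the
quotient, here presented by an exact sequence. -/
lemma trace_eq_add_of_exact {M N Q : Type*} [AddCommGroup M] [Module k M] [Module.Finite k M]
    [AddCommGroup N] [Module k N] [AddCommGroup Q] [Module k Q]
    {i : N →ₗ[k] M} {π : M →ₗ[k] Q} (hi : Function.Injective i) (hπ : Function.Surjective π)
    (hex : Function.Exact i π) {f : End k M} {fN : End k N} {fQ : End k Q}
    (hfN : f ∘ₗ i = i ∘ₗ fN) (hfQ : π ∘ₗ f = fQ ∘ₗ π) :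
    LinearMap.trace k M f = LinearMap.trace k N fN + LinearMap.trace k Q fQ := by
  have : Module.Finite k N := Module.Finite.of_injective i hi
  have : Module.Finite k Q := Module.Finite.of_surjective π hπ
  obtain ⟨r, hr⟩ := i.exists_leftInverse_of_injective (LinearMap.ker_eq_bot.mpr hi)
  obtain ⟨s, hs⟩ := π.exists_rightInverse_of_surjective (LinearMap.range_eq_top.mpr hπ)
  let s' := s - i ∘ₗ r ∘ₗ s
  have hs' : π ∘ₗ s' = LinearMap.id := by
    have : π ∘ₗ i = 0 := hex.linearMap_comp_eq_zero
    rw [LinearMap.comp_sub, ← LinearMap.comp_assoc, this, LinearMap.zero_comp, sub_zero, hs]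
  have hsplit : i ∘ₗ r + s' ∘ₗ π = LinearMap.id := by
    ext m
    obtain ⟨n, hn⟩ := (hex (m - s (π m))).mp (by
      rw [map_sub, ← LinearMap.comp_apply, hs, LinearMap.id_apply, sub_self])
    have hm : m = i n + s (π m) := by rw [hn]; abel
    have h1 : r (i n) = n := LinearMap.congr_fun hr n
    have hrm : r m = n + r (s (π m)) := by
      conv_lhs => rw [hm]
      rw [map_add, h1]
    simp only [s', LinearMap.add_apply, LinearMap.comp_apply, LinearMap.sub_apply,
      LinearMap.id_apply, hrm, map_add]
    conv_rhs => rw [hm]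
    abel
  calc LinearMap.trace k M f
      = LinearMap.trace k M (i ∘ₗ (fN ∘ₗ r)) + LinearMap.trace k M ((f ∘ₗ s') ∘ₗ π) := by
        rw [← map_add, ← LinearMap.comp_assoc, ← hfN, LinearMap.comp_assoc, LinearMap.comp_assoc,
          ← LinearMap.comp_add, hsplit, LinearMap.comp_id]
    _ = _ := by
        rw [LinearMap.trace_comp_comm' (fN ∘ₗ r) i, LinearMap.trace_comp_comm' π (f ∘ₗ s'),
          LinearMap.comp_assoc, hr, ← LinearMap.comp_assoc, hfQ, LinearMap.comp_assoc, hs',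
          LinearMap.comp_id, LinearMap.comp_id]

lemma actionTrace_of_smul_eq_ite {M : Type*} [AddCommGroup M] [Module k M] [Module A M]
    [IsScalarTower k A M] [Module.Finite k M] {x : A} {c : Prop} [Decidable c] {t : Finset M}
    (ht : Submodule.span k (t : Set M) = ⊤) (h : ∀ z ∈ t, x • z = if c then z else 0) :
    actionTrace k M x = if c then (finrank k M : k) else 0 := by
  have : (Algebra.lsmul k k M x : M →ₗ[k] M) = if c then LinearMap.id else 0 := by
    refine LinearMap.ext_on ht fun z hz => ?_
    by_cases hc : c <;> simpa [hc] using h z hz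
  unfold actionTrace
  rw [this]
  by_cases hc : c <;> simp [hc]

/-- Two finite families of simple modules, of total dimensions less than the characteristic, whose
sums have the same traces agree up to isomorphism and order. -/
theorem exists_equiv_of_sum_actionTrace_eq {p : ℕ} [CharP k p] {α β : Type*} [Fintype α]
    [Fintype β] (F : α → Type u) [∀ i, AddCommGroup (F i)] [∀ i, Module k (F i)]
    [∀ i, Module A (F i)] [∀ i, IsScalarTower k A (F i)] [∀ i, Module.Finite k (F i)]
    [∀ i, IsSimpleModule A (F i)]
    (X : β → Type v) [∀ i, AddCommGroup (X i)] [∀ i, Module k (X i)]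
    [∀ i, Module A (X i)] [∀ i, IsScalarTower k A (X i)] [∀ i, Module.Finite k (X i)]
    [∀ i, IsSimpleModule A (X i)]
    (hF : ∑ i, finrank k (F i) < p) (hX : ∑ i, finrank k (X i) < p)
    (h : ∀ x : A, ∑ i, actionTrace k (F i) x = ∑ i, actionTrace k (X i) x) :
    ∃ e : α ≃ β, ∀ i, Nonempty (F i ≃ₗ[A] X (e i)) := by
  classical
  let Z : α ⊕ β → ModuleCat.{max u v} A := Sum.elim
    (fun i => ModuleCat.of A (ULift.{v} (F i))) (fun i => ModuleCat.of A (ULift.{u} (X i)))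
  have hZ : ∀ q, IsSimpleModule A (Z q) := by
    rintro (i | i)
    · exact IsSimpleModule.congr (ULift.moduleEquiv : ULift.{v} (F i) ≃ₗ[A] F i)
    · exact IsSimpleModule.congr (ULift.moduleEquiv : ULift.{u} (X i) ≃ₗ[A] X i)
  let S : Setoid (α ⊕ β) :=
    { r := fun q q' => Nonempty (Z q ≃ₗ[A] Z q')
      iseqv := ⟨fun q => ⟨LinearEquiv.refl A _⟩, fun ⟨e⟩ => ⟨e.symm⟩,
        fun ⟨e⟩ ⟨e'⟩ => ⟨e.trans e'⟩⟩ }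
  let d : α ⊕ β → ℕ := Sum.elim (fun i => finrank k (F i)) (fun i => finrank k (X i))
  have hiso : ∀ q q', S.r q q' → d q = d q' := by
    rintro (i | i) (i' | i') ⟨e⟩
    · exact (((ULift.moduleEquiv.symm.trans e).trans ULift.moduleEquiv :
        F i ≃ₗ[A] F i').restrictScalars k).finrank_eq
    · exact (((ULift.moduleEquiv.symm.trans e).trans ULift.moduleEquiv :
        F i ≃ₗ[A] X i').restrictScalars k).finrank_eq
    · exact (((ULift.moduleEquiv.symm.trans e).trans ULift.moduleEquiv :
        X i ≃ₗ[A] F i').restrictScalars k).finrank_eq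
    · exact (((ULift.moduleEquiv.symm.trans e).trans ULift.moduleEquiv :
        X i ≃ₗ[A] X i').restrictScalars k).finrank_eq
  have hdpos : ∀ q, 0 < d q := by
    rintro (i | i)
    · have := IsSimpleModule.nontrivial A (F i)
      exact finrank_pos
    · have := IsSimpleModule.nontrivial A (X i)
      exact finrank_pos
  let f : α → Quotient S := fun i => Quotient.mk S (Sum.inl i)
  let g : β → Quotient S := fun i => Quotient.mk S (Sum.inr i)
  have hcard : ∀ c : Quotient S, (Finset.univ.filter fun i => f i = c).card
      = (Finset.univ.filter fun i => g i = c).card := by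
    intro c
    let C : α ⊕ β → Prop := fun q => Quotient.mk S q = c
    choose sF hsF using fun i => (inferInstance : Module.Finite k (F i)).fg_top
    choose sX hsX using fun i => (inferInstance : Module.Finite k (X i)).fg_top
    obtain ⟨x, hx⟩ := exists_smul_eq_ite Z C
      (fun q q' hq hc => (Quotient.sound (s := S) (Setoid.symm' S hq)).trans hc)
      (fun q => match q with
        | Sum.inl i => (sF i).image (fun z => (ULift.up z : ULift.{v} (F i)))
        | Sum.inr i => (sX i).image (fun z => (ULift.up z : ULift.{u} (X i))))
    have trF : ∀ i, actionTrace k (F i) x = if f i = c then (finrank k (F i) : k) else 0 :=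
      fun i => actionTrace_of_smul_eq_ite (hsF i) fun z hz => by
        refine (congrArg ULift.down (hx (Sum.inl i) ⟨z⟩ (Finset.mem_image_of_mem _ hz))).trans ?_
        change (if f i = c then (ULift.up z : ULift.{v} (F i)) else 0).down = _
        split_ifs <;> rfl
    have trX : ∀ i, actionTrace k (X i) x = if g i = c then (finrank k (X i) : k) else 0 :=
      fun i => actionTrace_of_smul_eq_ite (hsX i) fun z hz => by
        refine (congrArg ULift.down (hx (Sum.inr i) ⟨z⟩ (Finset.mem_image_of_mem _ hz))).trans ?_
        change (if g i = c then (ULift.up z : ULift.{u} (X i)) else 0).down = _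
        split_ifs <;> rfl
    obtain ⟨q, rfl⟩ := Quotient.exists_rep c
    have sumF : ∑ i ∈ Finset.univ.filter (fun i => f i = Quotient.mk S q), finrank k (F i)
        = (Finset.univ.filter fun i => f i = Quotient.mk S q).card * d q :=
      Finset.sum_const_nat fun i hi =>
        hiso (Sum.inl i) q (Quotient.exact (Finset.mem_filter.mp hi).2)
    have sumX : ∑ i ∈ Finset.univ.filter (fun i => g i = Quotient.mk S q), finrank k (X i)
        = (Finset.univ.filter fun i => g i = Quotient.mk S q).card * d q :=
      Finset.sum_const_nat fun i hi =>
        hiso (Sum.inr i) q (Quotient.exact (Finset.mem_filter.mp hi).2)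
    have hsum := h x
    simp only [trF, trX, ← Finset.sum_filter, ← Nat.cast_sum] at hsum
    rw [sumF, sumX, CharP.cast_eq_iff_mod_eq k p, Nat.mod_eq_of_lt, Nat.mod_eq_of_lt] at hsum
    · exact Nat.eq_of_mul_eq_mul_right (hdpos q) hsum
    · rw [← sumX]
      exact (Finset.sum_le_univ_sum_of_nonneg fun _ => Nat.zero_le _).trans_lt hX
    · rw [← sumF]
      exact (Finset.sum_le_univ_sum_of_nonneg fun _ => Nat.zero_le _).trans_lt hF
  let e : α ≃ β := Equiv.ofFiberEquiv (f := f) (g := g) fun c =>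
    Fintype.equivOfCardEq (by rw [Fintype.card_subtype, Fintype.card_subtype, hcard])
  refine ⟨e, fun i => ?_⟩
  obtain ⟨φ⟩ := Quotient.exact (Equiv.ofFiberEquiv_map (f := f) (g := g) _ i)
  exact ⟨((ULift.moduleEquiv.symm.trans φ).trans ULift.moduleEquiv :
        X (e i) ≃ₗ[A] F i).symm⟩

lemma actionTrace_eq_add {M : Type*} [AddCommGroup M] [Module k M] [Module A M]
    [IsScalarTower k A M] [Module.Finite k M] {N N' : Submodule A M} (hle : N ≤ N') (x : A) :
    actionTrace k N' x = actionTrace k N x + actionTrace k (N' ⧸ N.submoduleOf N') x := by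
  have : Module.Finite k N' :=
    Module.Finite.of_injective (N'.subtype.restrictScalars k) N'.injective_subtype
  refine trace_eq_add_of_exact (i := (Submodule.inclusion hle).restrictScalars k)
    (π := (N.submoduleOf N').mkQ.restrictScalars k)
    (Submodule.inclusion_injective hle) (Submodule.mkQ_surjective (N.submoduleOf N')) ?_ ?_ ?_
  · intro y
    simp only [LinearMap.coe_restrictScalars, Submodule.mkQ_apply, Submodule.Quotient.mk_eq_zero,
      Set.mem_range]
    exact ⟨fun hy => ⟨⟨y, hy⟩, rfl⟩, by rintro ⟨z, rfl⟩; exact z.2⟩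
  · ext z; rfl
  · ext z; rfl

lemma actionTrace_of_subsingleton (M : Type*) [AddCommGroup M] [Module k M] [Module A M]
    [IsScalarTower k A M] [Subsingleton M] (x : A) : actionTrace k M x = 0 := by
  unfold actionTrace
  rw [Subsingleton.elim (Algebra.lsmul k k M x : M →ₗ[k] M) 0, map_zero]

lemma last_eq_sum_of_succ_eq_add {R : Type*} [AddCommMonoid R] :
    ∀ {n : ℕ} {t : Fin (n + 1) → R} {d : Fin n → R} (_ : t 0 = 0)
      (_ : ∀ m, t m.succ = t m.castSucc + d m), t (Fin.last n) = ∑ m, d m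
  | 0, _, _, h0, _ => by simpa using h0
  | n + 1, t, d, h0, h => by
    rw [Fin.sum_univ_castSucc, ← last_eq_sum_of_succ_eq_add (t := fun m => t m.castSucc)
      (d := fun m => d m.castSucc) h0 fun m => h m.castSucc]
    exact h (Fin.last n)

/-- The trace on a module is the sum of the traces on the factors of a composition series. -/
lemma actionTrace_eq_sum {M : Type*} [AddCommGroup M] [Module k M] [Module A M]
    [IsScalarTower k A M] [Module.Finite k M] (s : CompositionSeries (Submodule A M))
    (h0 : s.head = ⊥) (h1 : s.last = ⊤) (x : A) :
    actionTrace k M x = ∑ m : Fin s.length,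
      actionTrace k (s m.succ ⧸ (s m.castSucc).submoduleOf (s m.succ)) x := by
  rw [← last_eq_sum_of_succ_eq_add (t := fun m => actionTrace k (s m) x)]
  · exact (actionTrace_congr (k := k) (A := A)
      ((LinearEquiv.ofEq _ _ h1).trans Submodule.topEquiv : s.last ≃ₗ[A] M) x).symm
  · have : Subsingleton (s 0) := by
      rw [show s 0 = ⊥ from h0]; infer_instance
    exact actionTrace_of_subsingleton _ x
  · exact fun m => actionTrace_eq_add (s.step m).le x

lemma sum_finrank_factors {M : Type*} [AddCommGroup M] [Module k M] [Module A M]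
    [IsScalarTower k A M] [Module.Finite k M] (s : CompositionSeries (Submodule A M))
    (h0 : s.head = ⊥) (h1 : s.last = ⊤) :
    finrank k M = ∑ m : Fin s.length,
      finrank k (s m.succ ⧸ (s m.castSucc).submoduleOf (s m.succ)) := by
  rw [← last_eq_sum_of_succ_eq_add (t := fun m => finrank k (s m))]
  · exact (((LinearEquiv.ofEq _ _ h1).trans Submodule.topEquiv :
      s.last ≃ₗ[A] M).restrictScalars k).finrank_eq.symm
  · have : Subsingleton (s 0) := by
      rw [show s 0 = ⊥ from h0]; infer_instance
    exact finrank_zero_of_subsingleton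
  · intro m
    have : Module.Finite k (s m.succ) :=
      Module.Finite.of_injective ((s m.succ).subtype.restrictScalars k)
        (s m.succ).injective_subtype
    let N := ((s m.castSucc).submoduleOf (s m.succ))
    have e := ((Submodule.submoduleOfEquivOfLe (s.step m).le).restrictScalars k).finrank_eq
    have h := Submodule.finrank_quotient_add_finrank (N.restrictScalars k)
    rw [← e, add_comm]
    exact h.symm

/-- A module of dimension less than the characteristic whose trace is the sum of the traces of
simple modules has these as its composition factors. -/
theorem exists_compositionSeries_of_actionTrace_eq {p : ℕ} [CharP k p] {M : Type u}
    [AddCommGroup M] [Module k M] [Module A M] [IsScalarTower k A M] [Module.Finite k M]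
    {β : Type*} [Fintype β] (X : β → Type v) [∀ i, AddCommGroup (X i)] [∀ i, Module k (X i)]
    [∀ i, Module A (X i)] [∀ i, IsScalarTower k A (X i)] [∀ i, Module.Finite k (X i)]
    [∀ i, IsSimpleModule A (X i)]
    (hM : finrank k M < p) (hX : ∑ i, finrank k (X i) < p)
    (h : ∀ x : A, actionTrace k M x = ∑ i, actionTrace k (X i) x) :
    ∃ s : CompositionSeries (Submodule A M), s.head = ⊥ ∧ s.last = ⊤ ∧
      ∃ e : Fin s.length ≃ β, ∀ m, Nonempty
        ((s m.succ ⧸ (s m.castSucc).submoduleOf (s m.succ)) ≃ₗ[A] X (e m)) := by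
  have : IsNoetherian A M := isNoetherian_of_tower k inferInstance
  have : IsArtinian A M := isArtinian_of_tower k inferInstance
  obtain ⟨s, h0, h1⟩ := exists_compositionSeries_of_isNoetherian_isArtinian A M
  refine ⟨s, h0, h1, ?_⟩
  have hfin : ∀ m : Fin s.length,
      Module.Finite k (s m.succ ⧸ (s m.castSucc).submoduleOf (s m.succ)) := fun m =>
    have : Module.Finite k (s m.succ) := Module.Finite.of_injective
      ((s m.succ).subtype.restrictScalars k) (s m.succ).injective_subtype
    Module.Finite.of_surjective
      (((s m.castSucc).submoduleOf (s m.succ)).mkQ.restrictScalars k)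
      (Submodule.mkQ_surjective ((s m.castSucc).submoduleOf (s m.succ)))
  have hsimple : ∀ m : Fin s.length,
      IsSimpleModule A (s m.succ ⧸ (s m.castSucc).submoduleOf (s m.succ)) := fun m =>
    (covBy_iff_quot_is_simple (s.step m).le).mp (s.step m)
  exact exists_equiv_of_sum_actionTrace_eq (p := p)
    (fun m : Fin s.length => s m.succ ⧸ (s m.castSucc).submoduleOf (s m.succ)) X 
    ((sum_finrank_factors (k := k) s h0 h1).symm.trans_lt hM) hX
    fun x => (actionTrace_eq_sum s h0 h1 x).symm.trans (h x)

end BrauerNesbitt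

section BinaryForms

open MvPolynomial

variable {R : Type*} [CommRing R]

/-- The linear substitution `e_j ↦ ∑ i, M_{ij} e_i` in binary forms. -/
def linSubst (M : Matrix (Fin 2) (Fin 2) R) : MvPolynomial (Fin 2) R →ₐ[R] MvPolynomial (Fin 2) R :=
  aeval fun j => ∑ i, C (M i j) * X i

lemma linSubst_X (M : Matrix (Fin 2) (Fin 2) R) (j : Fin 2) :
    linSubst M (X j) = C (M 0 j) * X 0 + C (M 1 j) * X 1 := by
  simp [linSubst]

lemma linSubst_one : linSubst (1 : Matrix (Fin 2) (Fin 2) R) = AlgHom.id R _ := by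
  ext j : 1
  simp [linSubst, Matrix.one_apply]

lemma linSubst_mul (M N : Matrix (Fin 2) (Fin 2) R) :
    linSubst (M * N) = (linSubst M).comp (linSubst N) := by
  ext j : 1
  simp [linSubst, Matrix.mul_apply]
  ring

lemma map_linSubst {S : Type*} [CommRing S] (f : R →+* S) (M : Matrix (Fin 2) (Fin 2) R)
    (q : MvPolynomial (Fin 2) R) :
    map f (linSubst M q) = linSubst (M.map f) (map f q) := by
  have : (map f).comp (linSubst M).toRingHom
      = (linSubst (M.map f)).toRingHom.comp (map f) := by
    ext j
    · simp [linSubst]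
    · simp [linSubst]
  exact RingHom.congr_fun this q

lemma linSubst_mem (M : Matrix (Fin 2) (Fin 2) R) (r : ℕ) (q : MvPolynomial (Fin 2) R)
    (hq : q ∈ homogeneousSubmodule (Fin 2) R r) :
    (linSubst M).toLinearMap q ∈ homogeneousSubmodule (Fin 2) R r := by
  rw [mem_homogeneousSubmodule] at *
  have := IsHomogeneous.aeval (n := 1) hq (fun j => ∑ i, C (M i j) * X i) (fun j =>
    IsHomogeneous.sum _ _ _ fun i _ => by
      simpa using (isHomogeneous_C (Fin 2) _).mul (isHomogeneous_X R i))
  simpa [linSubst] using this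

/-- The linear substitution on forms of degree `r`. -/
def formSubst (r : ℕ) (M : Matrix (Fin 2) (Fin 2) R) :
    Module.End R (homogeneousSubmodule (Fin 2) R r) :=
  (linSubst M).toLinearMap.restrict (linSubst_mem M r)

lemma formSubst_mul (r : ℕ) (M N : Matrix (Fin 2) (Fin 2) R) :
    formSubst r (M * N) = formSubst r M * formSubst r N := by
  ext f : 2
  simp [formSubst, LinearMap.restrict_apply, linSubst_mul]

lemma formSubst_one (r : ℕ) : formSubst r (1 : Matrix (Fin 2) (Fin 2) R) = 1 := by
  ext f : 2
  simp [formSubst, LinearMap.restrict_apply, linSubst_one]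

/-- The exponent of the monomial `e_0 ^ (r - i) e_1 ^ i`. -/
def formExp (r i : ℕ) : Fin 2 →₀ ℕ := Finsupp.single 0 (r - i) + Finsupp.single 1 i

lemma formExp_zero (r i : ℕ) : formExp r i 0 = r - i := by simp [formExp]

lemma formExp_one (r i : ℕ) : formExp r i 1 = i := by simp [formExp]

lemma formExp_injective (r : ℕ) : Function.Injective (formExp r) := fun i j h => by
  rw [← formExp_one r i, h, formExp_one]

lemma degree_formExp {r i : ℕ} (h : i ≤ r) : Finsupp.degree (formExp r i) = r := by
  rw [formExp, map_add, Finsupp.degree_single, Finsupp.degree_single, Nat.sub_add_cancel h]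

lemma eq_formExp {r : ℕ} {d : Fin 2 →₀ ℕ} (h : Finsupp.degree d = r) : d = formExp r (d 1) := by
  have h' : d 0 + d 1 = r := by simpa [Finsupp.degree_eq_sum] using h
  ext i
  fin_cases i
  · simp [formExp, ← h']
  · simp [formExp]

lemma monomial_formExp (r i : ℕ) (c : R) :
    monomial (formExp r i) c = C c * X 0 ^ (r - i) * X 1 ^ i := by
  rw [X_pow_eq_monomial, X_pow_eq_monomial, C_mul_monomial, monomial_mul]
  simp [formExp]

lemma eq_sum_monomial {r : ℕ} {q : MvPolynomial (Fin 2) R}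
    (hq : q ∈ homogeneousSubmodule (Fin 2) R r) :
    q = ∑ i : Fin (r + 1), monomial (formExp r i) (coeff (formExp r i) q) := by
  classical
  rw [mem_homogeneousSubmodule] at hq
  ext d
  simp only [coeff_sum, coeff_monomial]
  by_cases hd : Finsupp.degree d = r
  · have hd' := eq_formExp hd
    have hlt : d 1 < r + 1 := by
      have h' : d 0 + d 1 = r := by simpa [Finsupp.degree_eq_sum] using hd
      omega
    rw [Finset.sum_eq_single ⟨d 1, hlt⟩]
    · rw [if_pos hd'.symm, ← hd']
    · intro i _ hi
      rw [if_neg]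
      intro h
      rw [hd'] at h
      exact hi (Fin.ext (formExp_injective r h))
    · simp
  · rw [hq.coeff_eq_zero hd, Finset.sum_eq_zero]
    intro i _
    rw [if_neg]
    rintro rfl
    exact hd (degree_formExp (Nat.lt_succ_iff.mp i.2))

variable (R) in
/-- The basis of monomials `e_0 ^ (r - i) e_1 ^ i` of the space of forms of degree `r`. -/
def formBasis (r : ℕ) : Module.Basis (Fin (r + 1)) R (homogeneousSubmodule (Fin 2) R r) :=
  Module.Basis.ofEquivFun
    { toFun := fun q i => coeff (formExp r i) (q : MvPolynomial (Fin 2) R)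
      map_add' := fun q q' => by ext i; simp
      map_smul' := fun c q => by ext i; simp
      invFun := fun c => ⟨∑ i : Fin (r + 1), monomial (formExp r i) (c i),
        Submodule.sum_mem _ fun i _ =>
          isHomogeneous_monomial _ (degree_formExp (Nat.lt_succ_iff.mp i.2))⟩
      left_inv := fun q => Subtype.ext (eq_sum_monomial q.2).symm
      right_inv := fun c => by
        classical
        ext i
        simp only [coeff_sum, coeff_monomial, (formExp_injective r).eq_iff, Fin.val_inj]
        simp }

lemma formBasis_repr (r : ℕ) (q : homogeneousSubmodule (Fin 2) R r) (i : Fin (r + 1)) :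
    (formBasis R r).repr q i = coeff (formExp r i) (q : MvPolynomial (Fin 2) R) := rfl

lemma coe_formBasis (r : ℕ) (i : Fin (r + 1)) :
    (formBasis R r i : MvPolynomial (Fin 2) R) = monomial (formExp r i) 1 := by
  classical
  have := eq_sum_monomial (formBasis R r i).2
  simp only [← formBasis_repr, Module.Basis.repr_self, Finsupp.single_apply] at this
  rw [this, Finset.sum_eq_single i] <;> simp +contextual [eq_comm]

lemma trace_formSubst (r : ℕ) (M : Matrix (Fin 2) (Fin 2) R) :
    LinearMap.trace R _ (formSubst r M) =
      ∑ i : Fin (r + 1), coeff (formExp r i) (linSubst M (monomial (formExp r i) 1)) := by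
  classical
  rw [LinearMap.trace_eq_matrix_trace R (formBasis R r), Matrix.trace]
  refine Finset.sum_congr rfl fun i _ => ?_
  rw [Matrix.diag_apply, LinearMap.toMatrix_apply, formBasis_repr, formSubst,
    LinearMap.coe_restrict_apply, coe_formBasis]
  rfl

lemma map_trace_formSubst {S : Type*} [CommRing S] (f : R →+* S) (r : ℕ)
    (M : Matrix (Fin 2) (Fin 2) R) :
    f (LinearMap.trace R _ (formSubst r M)) = LinearMap.trace S _ (formSubst r (M.map f)) := by
  rw [trace_formSubst, trace_formSubst, map_sum]
  refine Finset.sum_congr rfl fun i _ => ?_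
  rw [← coeff_map, map_linSubst, map_monomial, map_one]

lemma trace_formSubst_of_triangular (r : ℕ) {M : Matrix (Fin 2) (Fin 2) R} (hM : M 1 0 = 0) :
    LinearMap.trace R _ (formSubst r M) =
      ∑ i ∈ Finset.range (r + 1), M 0 0 ^ (r - i) * M 1 1 ^ i := by
  rw [trace_formSubst, Finset.sum_range]
  refine Finset.sum_congr rfl fun i _ => ?_
  obtain ⟨w, hw⟩ := sub_dvd_pow_sub_pow (C (M 0 1) * X 0 + C (M 1 1) * X 1)
    (C (M 1 1) * X 1 : MvPolynomial (Fin 2) R) i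
  have h1 : linSubst M (monomial (formExp r i) 1) =
      monomial (formExp r i) (M 0 0 ^ (r - i) * M 1 1 ^ (i : ℕ))
        + monomial (Finsupp.single 0 (r - i + 1)) (M 0 0 ^ (r - i) * M 0 1) * w := by
    rw [monomial_formExp, monomial_formExp, map_mul, map_mul, map_pow, map_pow, linSubst_X,
      linSubst_X, hM, eq_add_of_sub_eq hw, ← mul_one (M 0 0 ^ (r - i) * M 0 1), ← C_mul_monomial,
      ← X_pow_eq_monomial]
    simp
    ring
  rw [h1, coeff_add, coeff_monomial, if_pos rfl, coeff_monomial_mul', if_neg, add_zero]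
  intro h
  have := h 0
  rw [formExp_zero] at this
  simp at this

lemma trace_formSubst_of_conj (r : ℕ) {M T P : Matrix (Fin 2) (Fin 2) R} (hP : IsUnit P)
    (h : M * P = P * T) :
    LinearMap.trace R _ (formSubst r M) = LinearMap.trace R _ (formSubst r T) := by
  obtain ⟨u, rfl⟩ := hP
  have hT : T = u⁻¹.val * (M * u.val) := by rw [h, ← mul_assoc, Units.inv_mul, one_mul]
  rw [hT, formSubst_mul, formSubst_mul, LinearMap.trace_mul_comm, mul_assoc, ← formSubst_mul,
    Units.mul_inv, formSubst_one, mul_one]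

/-- If `t₁`, `t₂` are the roots of the characteristic polynomial of `M`, the trace of `M` on forms
of degree `r` is the complete homogeneous symmetric polynomial in `t₁`, `t₂`. -/
lemma trace_formSubst_eq {K : Type*} [Field K] (r : ℕ) (M : Matrix (Fin 2) (Fin 2) K) {t₁ t₂ : K}
    (htr : t₁ + t₂ = M.trace) (hdet : t₁ * t₂ = M.det) :
    LinearMap.trace K _ (formSubst r M) = ∑ i ∈ Finset.range (r + 1), t₁ ^ (r - i) * t₂ ^ i := by
  rw [Matrix.trace_fin_two] at htr
  rw [Matrix.det_fin_two] at hdet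
  by_cases hc : M 1 0 = 0
  · rw [trace_formSubst_of_triangular r hc]
    have hroot : (t₁ - M 0 0) * (t₁ - M 1 1) = 0 := by
      rw [hc] at hdet
      linear_combination t₁ * htr - hdet
    rcases mul_eq_zero.mp hroot with h | h
    · have h1 : t₁ = M 0 0 := sub_eq_zero.mp h
      have h2 : t₂ = M 1 1 := by rw [h1] at htr; linear_combination htr
      rw [h1, h2]
    · have h1 : t₁ = M 1 1 := sub_eq_zero.mp h
      have h2 : t₂ = M 0 0 := by rw [h1] at htr; linear_combination htr
      rw [h1, h2, ← Finset.sum_range_reflect]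
      refine Finset.sum_congr rfl fun i hi => ?_
      have := Finset.mem_range.mp hi
      rw [show r + 1 - 1 - i = r - i by omega, show r - (r - i) = i by omega, mul_comm]
  · let P : Matrix (Fin 2) (Fin 2) K := !![t₁ - M 1 1, 1; M 1 0, 0]
    let T : Matrix (Fin 2) (Fin 2) K := !![t₁, 1; 0, t₂]
    have hP : IsUnit P := by
      rw [Matrix.isUnit_iff_isUnit_det, isUnit_iff_ne_zero]
      simpa [P, Matrix.det_fin_two] using hc
    have h : M * P = P * T := by
      ext i j
      fin_cases i <;> fin_cases j <;> simp [P, T, Matrix.mul_apply, Fin.sum_univ_two]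
      · linear_combination -t₁ * htr + hdet
      · linear_combination -htr
      · ring
    rw [trace_formSubst_of_conj r hP h, trace_formSubst_of_triangular r rfl]
    rfl

end BinaryForms

section Irreducible

open MvPolynomial

variable (p : ℕ) [Fact p.Prime] (k : Type*) [Field k] [CharP k p]

lemma symSubst_eq_linSubst (g : GL (Fin 2) (ZMod p)) :
    symSubst p k g = linSubst (g.val.map (ZMod.castHom (dvd_refl p) k)) := rfl

lemma castHom_injective : Function.Injective (ZMod.castHom (dvd_refl p) k) :=
  (ZMod.castHom (dvd_refl p) k).injective

variable {p k}

/-- A form of degree `< p` invariant under `e_1 ↦ e_0 + e_1` is a multiple of a power of `e_0`. -/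
lemma eq_C_mul_X_pow_of_fixed {r : ℕ} (hr : r < p) {q : MvPolynomial (Fin 2) k}
    (hq : q ∈ homogeneousSubmodule (Fin 2) k r) (hfix : linSubst !![1, 1; 0, 1] q = q) :
    q = C (coeff (formExp r 0) q) * X 0 ^ r := by
  let δ : MvPolynomial (Fin 2) k →ₐ[k] Polynomial k := aeval ![1, Polynomial.X]
  have hδ : δ q = ∑ i : Fin (r + 1),
      Polynomial.C (coeff (formExp r i) q) * Polynomial.X ^ (i : ℕ) := by
    conv_lhs => rw [eq_sum_monomial hq]
    rw [map_sum]
    refine Finset.sum_congr rfl fun i _ => ?_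
    rw [monomial_formExp]
    simp [δ, Polynomial.C_eq_algebraMap]
  have hdeg : (δ q).natDegree ≤ r := by
    rw [hδ]
    exact Polynomial.natDegree_sum_le_of_forall_le _ _ fun i _ =>
      (Polynomial.natDegree_C_mul_X_pow_le _ _).trans (Nat.lt_succ_iff.mp i.2)
  have hshift : (δ q).comp (Polynomial.X + 1) = δ q := by
    have : (Polynomial.aeval (Polynomial.X + 1 : Polynomial k)).comp δ =
        δ.comp (linSubst !![1, 1; 0, 1]) := by
      ext j : 1
      fin_cases j <;> simp [δ, linSubst_X, add_comm]
    conv_rhs => rw [← hfix]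
    exact AlgHom.congr_fun this q
  have heval : ∀ n : ℕ, (δ q).eval (n : k) = (δ q).eval 0 := by
    intro n
    induction n with
    | zero => simp
    | succ n ih =>
      rw [← ih]
      conv_rhs => rw [← hshift]
      simp
  have hconst : δ q = Polynomial.C ((δ q).eval 0) := by
    refine Polynomial.eq_of_natDegree_lt_card_of_eval_eq _ _ (castHom_injective p k)
      (fun s => ?_) ?_
    · rw [Polynomial.eval_C, ← heval s.val, ZMod.castHom_apply, ZMod.natCast_val]
    · rw [ZMod.card, Polynomial.natDegree_C]
      exact max_lt (hdeg.trans_lt hr) (Nat.zero_le r |>.trans_lt hr)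
  have hcoeff : ∀ i : Fin (r + 1), (i : ℕ) ≠ 0 → coeff (formExp r i) q = 0 := by
    intro i hi
    have h1 : (δ q).coeff i = coeff (formExp r i) q := by
      rw [hδ, Polynomial.finsetSum_coeff, Finset.sum_eq_single i]
      · simp
      · intro j _ hj
        rw [Polynomial.coeff_C_mul_X_pow, if_neg]
        exact fun h => hj (Fin.ext h.symm)
      · simp
    rw [← h1, hconst, Polynomial.coeff_C_of_ne_zero hi]
  conv_lhs => rw [eq_sum_monomial hq]
  rw [Finset.sum_eq_single 0]
  · rw [monomial_formExp]
    simp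
  · intro i _ hi
    rw [hcoeff i (fun h => hi (Fin.ext h)), map_zero]
  · simp

lemma X_pow_mem_of_stable {r : ℕ} (hr : r < p) {N : Submodule k (MvPolynomial (Fin 2) k)}
    (hN : N ≤ homogeneousSubmodule (Fin 2) k r) (hN0 : N ≠ ⊥)
    (hstab : ∀ q ∈ N, linSubst !![1, 1; 0, 1] q ∈ N) : X 0 ^ r ∈ N := by
  let u : Module.End k (MvPolynomial (Fin 2) k) := (linSubst !![1, 1; 0, 1]).toLinearMap
  have hu : ∀ n : ℕ, u ^ n = (linSubst !![1, (n : k); 0, 1]).toLinearMap := by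
    intro n
    induction n with
    | zero =>
      rw [pow_zero, Nat.cast_zero, ← Matrix.one_fin_two, linSubst_one]
      rfl
    | succ n ih =>
      rw [pow_succ, ih]
      have : (!![1, ((n + 1 : ℕ) : k); 0, 1] : Matrix (Fin 2) (Fin 2) k)
          = !![1, (n : k); 0, 1] * !![1, 1; 0, 1] := by
        simp [add_comm]
      rw [this, linSubst_mul]
      rfl
  have : CharP (Module.End k (MvPolynomial (Fin 2) k)) p :=
    charP_of_injective_algebraMap (FaithfulSMul.algebraMap_injective k _) p
  have hnil : (u - 1) ^ p = 0 := by
    rw [sub_pow_char_of_commute p (Commute.one_right u), hu, CharP.cast_eq_zero,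
      ← Matrix.one_fin_two, linSubst_one, one_pow]
    exact sub_self _
  have hmem : ∀ n : ℕ, ∀ q ∈ N, ((u - 1) ^ n : Module.End k _) q ∈ N := by
    intro n
    induction n with
    | zero => simp
    | succ n ih =>
      intro q hq
      rw [pow_succ]
      exact ih _ (N.sub_mem (hstab q hq) hq)
  obtain ⟨q, hqN, hq0⟩ := N.exists_mem_ne_zero_of_ne_bot hN0
  classical
  have hex : ∃ n, ((u - 1) ^ n : Module.End k _) q = 0 := ⟨p, by rw [hnil]; rfl⟩
  obtain ⟨n, hn⟩ : ∃ n, Nat.find hex = n + 1 := Nat.exists_eq_succ_of_ne_zero fun h => hq0 <| by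
    simpa [h] using Nat.find_spec hex
  set f := ((u - 1) ^ n : Module.End k _) q with hf
  have hf0 : f ≠ 0 := Nat.find_min hex (by omega)
  have hfN : f ∈ N := hmem n q hqN
  have hfix : linSubst !![1, 1; 0, 1] f = f := by
    have := Nat.find_spec hex
    rw [hn, pow_succ', Module.End.mul_apply] at this
    exact sub_eq_zero.mp this
  have hform := eq_C_mul_X_pow_of_fixed hr (hN hfN) hfix
  have hc : coeff (formExp r 0) f ≠ 0 := by
    intro h
    rw [h, map_zero, zero_mul] at hform
    exact hf0 hform
  have hX : X 0 ^ r = (coeff (formExp r 0) f)⁻¹ • f := by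
    generalize coeff (formExp r 0) f = c at hform hc
    rw [hform, smul_eq_C_mul, ← mul_assoc, ← map_mul, inv_mul_cancel₀ hc, map_one, one_mul]
  rw [hX]
  exact N.smul_mem _ hfN

/-- The forms `(e_0 + s e_1) ^ r`, `s ∈ 𝔽_p`, span the space of forms of degree `r < p`. -/
lemma homogeneousSubmodule_le_of_pow_mem {r : ℕ} (hr : r < p)
    {N : Submodule k (MvPolynomial (Fin 2) k)}
    (h : ∀ s : ZMod p, (X 0 + C (ZMod.castHom (dvd_refl p) k s) * X 1) ^ r ∈ N) :
    homogeneousSubmodule (Fin 2) k r ≤ N := by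
  intro q hq
  by_contra hqN
  obtain ⟨φ, hφ, hφN⟩ := Submodule.exists_le_ker_of_notMem hqN
  let c : ℕ → k := fun i => φ (monomial (formExp r i) 1)
  let Q : Polynomial k := ∑ i ∈ Finset.range (r + 1),
    Polynomial.C ((r.choose i : k) * c i) * Polynomial.X ^ i
  have hQ : Q = 0 := by
    refine Polynomial.eq_of_natDegree_lt_card_of_eval_eq _ _ (castHom_injective p k)
      (fun s => ?_) ?_
    · have hs := hφN (h s)
      rw [LinearMap.mem_ker, add_comm, add_pow, map_sum] at hs
      rw [Polynomial.eval_zero, ← hs, Polynomial.eval_finsetSum]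
      refine Finset.sum_congr rfl fun i _ => ?_
      have : (C (ZMod.castHom (dvd_refl p) k s) * X 1) ^ i * X 0 ^ (r - i) *
          (r.choose i : MvPolynomial (Fin 2) k) = (ZMod.castHom (dvd_refl p) k s ^ i * (r.choose i : k)) •
            (monomial (formExp r i) 1 : MvPolynomial (Fin 2) k) := by
        rw [monomial_formExp, smul_eq_C_mul]
        simp only [map_mul, map_pow, map_natCast, map_one]
        ring
      rw [this, map_smul, smul_eq_mul]
      simp only [Polynomial.eval_mul, Polynomial.eval_C, Polynomial.eval_pow, Polynomial.eval_X, c]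
      ring
    · rw [ZMod.card, Polynomial.natDegree_zero, max_eq_left (Nat.zero_le _)]
      refine lt_of_le_of_lt (Polynomial.natDegree_sum_le_of_forall_le _ _ fun i hi => ?_) hr
      exact (Polynomial.natDegree_C_mul_X_pow_le _ _).trans
        (Nat.lt_succ_iff.mp (Finset.mem_range.mp hi))
  have hc : ∀ i, i ≤ r → c i = 0 := by
    intro i hi
    have h1 : Q.coeff i = (r.choose i : k) * c i := by
      rw [Polynomial.finsetSum_coeff, Finset.sum_eq_single i]
      · rw [Polynomial.coeff_C_mul_X_pow, if_pos rfl]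
      · intro j _ hj
        rw [Polynomial.coeff_C_mul_X_pow, if_neg (Ne.symm hj)]
      · intro hi'
        exact absurd (Finset.mem_range.mpr (Nat.lt_succ_iff.mpr hi)) hi'
    rw [hQ, Polynomial.coeff_zero] at h1
    refine (mul_eq_zero.mp h1.symm).resolve_left ?_
    intro hzero
    have hdvd := (CharP.cast_eq_zero_iff k p _).mp hzero
    have hp : p.Prime := Fact.out
    have := (hdvd.trans ⟨i.factorial * (r - i).factorial, by
      rw [← mul_assoc, Nat.choose_mul_factorial_mul_factorial hi]⟩ : p ∣ r.factorial)
    exact absurd (hp.dvd_factorial.mp this) (not_le.mpr hr)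
  apply hφ
  rw [eq_sum_monomial hq, map_sum]
  refine Finset.sum_eq_zero fun i _ => ?_
  rw [← mul_one (coeff (formExp r i) q), ← smul_eq_mul, ← smul_monomial, map_smul]
  simp [show φ (monomial (formExp r i) 1) = 0 from hc i (Nat.lt_succ_iff.mp i.2)]

/-- The space of forms of degree `r < p` has no proper nonzero `GL₂(𝔽_p)`-stable subspace. -/
lemma eq_homogeneousSubmodule_of_stable {r : ℕ} (hr : r < p)
    {N : Submodule k (MvPolynomial (Fin 2) k)}
    (hN : N ≤ homogeneousSubmodule (Fin 2) k r) (hN0 : N ≠ ⊥)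
    (hstab : ∀ g : GL (Fin 2) (ZMod p), ∀ q ∈ N, symSubst p k g q ∈ N) :
    N = homogeneousSubmodule (Fin 2) k r := by
  refine le_antisymm hN (homogeneousSubmodule_le_of_pow_mem hr fun s => ?_)
  have hX : X 0 ^ r ∈ N := X_pow_mem_of_stable hr hN hN0 fun q hq => by
    let g : GL (Fin 2) (ZMod p) := Matrix.GeneralLinearGroup.mkOfDetNeZero !![1, 1; 0, 1] (by simp)
    have := hstab g q hq
    rw [symSubst_eq_linSubst] at this
    have hg : g.val.map (ZMod.castHom (dvd_refl p) k) = !![1, 1; 0, 1] := by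
      ext i j
      fin_cases i <;> fin_cases j <;>
        simp [g, Matrix.GeneralLinearGroup.mkOfDetNeZero]
    rwa [hg] at this
  let g : GL (Fin 2) (ZMod p) := Matrix.GeneralLinearGroup.mkOfDetNeZero !![1, 0; s, 1] (by simp)
  have := hstab g _ hX
  rw [symSubst_eq_linSubst, map_pow, linSubst_X] at this
  simpa [g, Matrix.GeneralLinearGroup.mkOfDetNeZero] using this

variable (k) in
lemma symSpace_natCast (r : ℕ) : symSpace k (r : ℤ) = homogeneousSubmodule (Fin 2) k r := by
  simp [symSpace]

variable (k) in
lemma symSpace_neg {n : ℤ} (hn : n < 0) : symSpace k n = ⊥ := by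
  simp [symSpace, hn]

instance finite_symSpace (n : ℤ) : Module.Finite k (symSpace k n) := by
  rcases lt_or_ge n 0 with hn | hn
  · rw [symSpace_neg k hn]; infer_instance
  · lift n to ℕ using hn
    rw [symSpace_natCast]
    exact Module.Finite.of_basis (formBasis k n)

variable (k) in
lemma finrank_symSpace (n : ℤ) : Module.finrank k (symSpace k n) = (n + 1).toNat := by
  rcases lt_or_ge n 0 with hn | hn
  · rw [symSpace_neg k hn, finrank_bot]; omega
  · lift n to ℕ using hn
    rw [symSpace_natCast, Module.finrank_eq_card_basis (formBasis k n), Fintype.card_fin]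
    omega

lemma detPow_ne_zero (m : ℤ) (g : GL (Fin 2) (ZMod p)) : detPow p k m g ≠ 0 :=
  ((Group.isUnit g).map (detPow p k m)).ne_zero

lemma isSimpleModule_detSymRep (m n : ℤ) (h0 : 0 ≤ n) (hn : n < p) :
    IsSimpleModule (MonoidAlgebra k (GL (Fin 2) (ZMod p))) (detSymRep p k m n).asModule := by
  rw [← Representation.irreducible_iff_isSimpleModule_asModule]
  have hnt : Nontrivial (symSpace k n) := by
    rw [← Module.finrank_pos_iff (R := k), finrank_symSpace]
    omega
  lift n to ℕ using h0
  have hr : n < p := by exact_mod_cast hn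
  refine { exists_pair_ne := ⟨⊥, ⊤, fun h => ?_⟩, eq_bot_or_eq_top := fun W => ?_ }
  · have := congrArg Subrepresentation.toSubmodule h
    exact bot_ne_top this
  · by_cases hW : W.toSubmodule = ⊥
    · exact Or.inl (Subrepresentation.toSubmodule_injective hW)
    · right
      apply Subrepresentation.toSubmodule_injective
      let N := W.toSubmodule.map (symSpace k (n : ℤ)).subtype
      have hN : N = homogeneousSubmodule (Fin 2) k n := by
        refine eq_homogeneousSubmodule_of_stable hr ?_ ?_ ?_
        · rw [← symSpace_natCast]
          exact Submodule.map_subtype_le _ _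
        · exact fun h => hW (Submodule.map_injective_of_injective
            (symSpace k (n : ℤ)).injective_subtype (h.trans (Submodule.map_bot _).symm))
        · rintro g _ ⟨q, hq, rfl⟩
          refine ⟨symRep p k n g q, ?_, rfl⟩
          have := W.toSubmodule.smul_mem (detPow p k m g)⁻¹ (W.apply_mem_toSubmodule g hq)
          change (detPow p k m g)⁻¹ • (detPow p k m g • symRep p k n g q) ∈ _ at this
          rwa [inv_smul_smul₀ (detPow_ne_zero m g)] at this
      rw [← symSpace_natCast] at hN
      have h2 : W.toSubmodule.map (symSpace k (n : ℤ)).subtype =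
          (⊤ : Submodule k (symSpace k (n : ℤ))).map (symSpace k (n : ℤ)).subtype := by
        rw [Submodule.map_subtype_top]
        exact hN
      exact Submodule.map_injective_of_injective (Submodule.injective_subtype _) h2

lemma trace_restrict_congr {V : Type*} [AddCommGroup V] [Module k V] {S T : Submodule k V}
    (h : S = T) (f : V →ₗ[k] V) (hS : ∀ x ∈ S, f x ∈ S) (hT : ∀ x ∈ T, f x ∈ T) :
    LinearMap.trace k S (f.restrict hS) = LinearMap.trace k T (f.restrict hT) := by
  subst h
  rfl

/-- The trace of `g` on `det ^ m ⊗ Sym ^ r`, in terms of the eigenvalues of `g`. -/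
lemma map_trace_detSymRep {K : Type*} [Field K] (f : k →+* K) (m : ℤ) (r : ℕ)
    (g : GL (Fin 2) (ZMod p)) {t₁ t₂ : K}
    (htr : t₁ + t₂ = f (ZMod.castHom (dvd_refl p) k g.val.trace))
    (hdet : t₁ * t₂ = f (ZMod.castHom (dvd_refl p) k g.val.det)) :
    f (LinearMap.trace k _ (detSymRep p k m r g)) =
      (t₁ * t₂) ^ m * ∑ i ∈ Finset.range (r + 1), t₁ ^ (r - i) * t₂ ^ i := by
  have h1 : detSymRep p k m r g = detPow p k m g • symRep p k r g := rfl
  have h2 : LinearMap.trace k _ (symRep p k r g) = LinearMap.trace k _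
      (formSubst r (g.val.map (ZMod.castHom (dvd_refl p) k))) :=
    trace_restrict_congr (symSpace_natCast k r) _ (symSubst_mem p k r g) (linSubst_mem _ r)
  have h3 : f (detPow p k m g) = (t₁ * t₂) ^ m := by
    rw [hdet, ← map_zpow₀, ← map_zpow₀]
    change f (ZMod.castHom (dvd_refl p) k
      ((Matrix.GeneralLinearGroup.det g ^ m : (ZMod p)ˣ) : ZMod p)) = _
    rw [Units.val_zpow_eq_zpow_val]
    rfl
  rw [h1, map_smul, smul_eq_mul, map_mul, h2, map_trace_formSubst, h3]
  congr 1
  refine trace_formSubst_eq r _ ?_ ?_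
  · rw [htr]
    simp [Matrix.trace_fin_two]
  · rw [hdet]
    simp [Matrix.det_fin_two]

end Irreducible

section CuspidalTrace

variable {p : ℕ} [Fact p.Prime] {Ω : Type*} [Field Ω]

open Classical in
/-- The elements of `𝔽_{p²}` whose characteristic polynomial over `𝔽_p` is that of `g`. -/
def eigenFiber (g : GL (Fin 2) (ZMod p)) : Finset (GaloisField p 2) :=
  (normFiber g.val.det).filter fun t => Algebra.trace (ZMod p) (GaloisField p 2) t = g.val.trace

lemma mem_eigenFiber {g : GL (Fin 2) (ZMod p)} {t : GaloisField p 2} :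
    t ∈ eigenFiber g ↔ t * t ^ p = algebraMap (ZMod p) (GaloisField p 2) g.val.det ∧
      t + t ^ p = algebraMap (ZMod p) (GaloisField p 2) g.val.trace := by
  rw [eigenFiber, Finset.mem_filter, mem_normFiber, ← norm_eq, ← trace_eq,
    (algebraMap (ZMod p) (GaloisField p 2)).injective.eq_iff,
    (algebraMap (ZMod p) (GaloisField p 2)).injective.eq_iff]

lemma sum_units_psi {ψ : AddChar (ZMod p) Ω} (hψ : ψ ≠ 1) (c : ZMod p) :
    ∑ x : (ZMod p)ˣ, ψ (x * c) = (if c = 0 then (p : Ω) else 0) - 1 := by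
  have h := AddChar.sum_mulShift c (AddChar.IsPrimitive.of_ne_one hψ)
  rw [← Finset.add_sum_erase _ _ (Finset.mem_univ (0 : ZMod p)), zero_mul,
    AddChar.map_zero_eq_one, ZMod.card] at h
  rw [← Nat.cast_zero (R := Ω), ← Nat.cast_ite, ← h, add_sub_cancel_left]
  refine Finset.sum_bij' (fun x _ => (x : ZMod p))
    (fun x hx => Units.mk0 x (Finset.ne_of_mem_erase hx)) ?_ ?_ ?_ ?_ ?_ <;> simp

lemma sum_eigenFiber_of_lower_eq_zero (χ : MulChar (GaloisField p 2) Ω)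
    {g : GL (Fin 2) (ZMod p)} (hc : g 1 0 = 0) :
    ∑ t ∈ eigenFiber g, χ t = if g 0 0 = g 1 1 then
      χ (algebraMap (ZMod p) (GaloisField p 2) (g 1 1)) else 0 := by
  have key : ∀ t ∈ eigenFiber g, g 0 0 = g 1 1 ∧
      t = algebraMap (ZMod p) (GaloisField p 2) (g 1 1) := by
    intro t ht
    rw [mem_eigenFiber, Matrix.det_fin_two, Matrix.trace_fin_two, hc, mul_zero, sub_zero, map_mul,
      map_add] at ht
    obtain ⟨h1, h2⟩ := ht
    have hroot : (t - algebraMap (ZMod p) (GaloisField p 2) (g 0 0)) *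
        (t - algebraMap (ZMod p) (GaloisField p 2) (g 1 1)) = 0 := by
      linear_combination t * h2 - h1
    have hbase : t ^ p = t := by
      rcases mul_eq_zero.mp hroot with h | h <;>
      · rw [sub_eq_zero.mp h, conj_base]
    rw [hbase] at h1 h2
    rcases mul_eq_zero.mp hroot with h | h
    · have h3 := sub_eq_zero.mp h
      have h4 : t = algebraMap (ZMod p) (GaloisField p 2) (g 1 1) := by
        linear_combination h2 - h3
      exact ⟨(algebraMap (ZMod p) (GaloisField p 2)).injective (h3.symm.trans h4), h4⟩
    · have h4 := sub_eq_zero.mp h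
      have h3 : t = algebraMap (ZMod p) (GaloisField p 2) (g 0 0) := by
        linear_combination h2 - h4
      exact ⟨(algebraMap (ZMod p) (GaloisField p 2)).injective (h3.symm.trans h4), h4⟩
  split_ifs with h
  · have : eigenFiber g = {algebraMap (ZMod p) (GaloisField p 2) (g 1 1)} := by
      refine Finset.eq_singleton_iff_unique_mem.mpr ⟨?_, fun t ht => (key t ht).2⟩
      rw [mem_eigenFiber, Matrix.det_fin_two, Matrix.trace_fin_two, hc, mul_zero, sub_zero, map_mul,
        map_add, conj_base, h]
      exact ⟨rfl, rfl⟩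
    rw [this, Finset.sum_singleton]
  · exact Finset.sum_eq_zero fun t ht => absurd (key t ht).1 h

open Classical in
/-- The character of the cuspidal representation. -/
lemma trace_cuspidalRep [CharZero Ω] (χ : MulChar (GaloisField p 2) Ω) (hχ : χ ^ p ≠ χ)
    (ψ : AddChar (ZMod p) Ω) (hψ : ψ ≠ 1) (g : GL (Fin 2) (ZMod p)) :
    LinearMap.trace Ω _ (cuspidalRep χ hχ ψ hψ g) = -∑ t ∈ eigenFiber g, χ t +
      p * if g 1 0 = 0 ∧ g 0 1 = 0 ∧ g 0 0 = g 1 1 then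
        χ (algebraMap (ZMod p) (GaloisField p 2) (g 1 1)) else 0 := by
  have hp0 : (p : Ω) ≠ 0 := Nat.cast_ne_zero.mpr (Fact.out : p.Prime).ne_zero
  have htr : LinearMap.trace Ω _ (cuspidalRep χ hχ ψ hψ g) =
      ∑ x, kirillovKernel χ ψ g x x := by
    change LinearMap.trace Ω _ (Matrix.toLin' _) = _
    rw [Matrix.trace_toLin'_eq]
    rfl
  rw [htr]
  have hdet := g.val.det_fin_two
  have hdet0 : g.val.det ≠ 0 := g.det.ne_zero
  by_cases hc : g 1 0 = 0
  · rw [sum_eigenFiber_of_lower_eq_zero χ hc]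
    have hd : g 1 1 ≠ 0 := by
      intro h
      rw [hc, h] at hdet
      simp [hdet] at hdet0
    by_cases had : g 0 0 = g 1 1
    · have h1 : ∀ x : (ZMod p)ˣ, kirillovKernel χ ψ g x x =
          χ (algebraMap (ZMod p) (GaloisField p 2) (g 1 1)) *
            ψ ((x : ZMod p) * (g 0 1 / g 1 1)) := by
        intro x
        simp only [kirillovKernel, if_pos hc, had, if_true]
        congr 2
        ring
      simp only [h1]
      rw [← Finset.mul_sum, sum_units_psi hψ, if_pos had]
      by_cases hb : g 0 1 = 0
      · rw [if_pos (by rw [hb, zero_div]), if_pos ⟨hc, hb, had⟩]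
        ring
      · rw [if_neg (div_ne_zero hb hd), if_neg (fun h => hb h.2.1)]
        ring
    · rw [if_neg had, if_neg (fun h => had h.2.2), Finset.sum_eq_zero]
      · simp
      · intro x _
        have : g 0 0 * (x : ZMod p) ≠ g 1 1 * (x : ZMod p) := fun h =>
          had (mul_right_cancel₀ x.ne_zero h)
        simp only [kirillovKernel, if_pos hc, if_neg this]
  · rw [if_neg (fun h => hc h.1), mul_zero, add_zero]
    have h1 : ∀ x : (ZMod p)ˣ, kirillovKernel χ ψ g x x =
        ∑ t ∈ normFiber g.val.det, -(p : Ω)⁻¹ * χ t * ψ ((x : ZMod p) *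
          ((g.val.trace - Algebra.trace (ZMod p) (GaloisField p 2) t) / g 1 0)) := by
      intro x
      simp only [kirillovKernel, if_neg hc, div_self x.ne_zero, one_mul]
      rw [Finset.mul_sum]
      refine Finset.sum_congr rfl fun t _ => ?_
      have : (x : ZMod p) * ((g.val.trace - Algebra.trace (ZMod p) (GaloisField p 2) t) / g 1 0) =
          (g 0 0 * (x : ZMod p) + g 1 1 * (x : ZMod p)) / g 1 0 +
            -((x : ZMod p) / g 1 0) * Algebra.trace (ZMod p) (GaloisField p 2) t := by
        rw [Matrix.trace_fin_two]
        ring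
      rw [this, AddChar.map_add_eq_mul]
      ring
    simp only [h1]
    rw [Finset.sum_comm]
    simp only [← Finset.mul_sum, sum_units_psi hψ, div_eq_zero_iff, hc, or_false, sub_eq_zero,
      mul_sub, Finset.sum_sub_distrib, mul_one]
    rw [sum_normFiber_eq_zero hχ _ hdet0, mul_zero, sub_zero, eigenFiber,
      Finset.sum_filter, ← Finset.sum_neg_distrib]
    refine Finset.sum_congr rfl fun t _ => ?_
    by_cases ht : g.val.trace = Algebra.trace (ZMod p) (GaloisField p 2) t
    · rw [if_pos ht, if_pos ht.symm]
      field_simp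
    · rw [if_neg ht, if_neg (Ne.symm ht)]
      simp

lemma exists_root_quadratic (τ D : ZMod p) : ∃ t : GaloisField p 2,
    t ^ 2 - algebraMap (ZMod p) (GaloisField p 2) τ * t
      + algebraMap (ZMod p) (GaloisField p 2) D = 0 := by
  let f : Polynomial (ZMod p) := Polynomial.X ^ 2 - Polynomial.C τ * Polynomial.X + Polynomial.C D
  have hf : f = Polynomial.C 1 * Polynomial.X ^ 2 + Polynomial.C (-τ) * Polynomial.X
      + Polynomial.C D := by
    simp [f, sub_eq_add_neg]
  have hdeg : f.natDegree = 2 := by rw [hf, Polynomial.natDegree_quadratic one_ne_zero]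
  have hmonic : f.Monic := by
    rw [Polynomial.Monic, hf, Polynomial.leadingCoeff_quadratic one_ne_zero]
  by_cases hirr : Irreducible f
  · have hdvd := hirr.natDegree_dvd_iff_dvd_X_pow_card_pow_sub_X.mp hdeg.dvd
    rw [Nat.card_zmod] at hdvd
    have hsplit : (f.map (algebraMap (ZMod p) (GaloisField p 2))).Splits := by
      refine Polynomial.Splits.of_dvd ?_ ?_
        (Polynomial.map_dvd (algebraMap (ZMod p) (GaloisField p 2)) hdvd)
      · exact Polynomial.SplittingField.splits
          (Polynomial.X ^ p ^ 2 - Polynomial.X : Polynomial (ZMod p))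
      · exact Polynomial.map_ne_zero (FiniteField.X_pow_card_pow_sub_X_ne_zero _ two_ne_zero
          (Fact.out : p.Prime).one_lt)
    obtain ⟨t, ht⟩ := hsplit.exists_eval_eq_zero (by
      rw [Polynomial.degree_map]
      exact Polynomial.degree_ne_of_natDegree_ne (by rw [hdeg]; norm_num))
    exact ⟨t, by simpa [f] using ht⟩
  · rw [hmonic.irreducible_iff_roots_eq_zero_of_degree_le_three (by omega) (by omega)] at hirr
    obtain ⟨s, hs⟩ := Multiset.exists_mem_of_ne_zero hirr
    have hs' : s ^ 2 - τ * s + D = 0 := by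
      simpa [f] using Polynomial.isRoot_of_mem_roots hs
    refine ⟨algebraMap (ZMod p) (GaloisField p 2) s, ?_⟩
    rw [← map_pow, ← map_mul, ← map_sub, ← map_add, hs', map_zero]

open Classical in
/-- The eigenvalues of `g` in `𝔽_{p²}`: either they are conjugate, or they are distinct elements of
`𝔽_p`. -/
lemma exists_eigenvalues (g : GL (Fin 2) (ZMod p)) : ∃ t₁ t₂ : GaloisField p 2,
    t₁ + t₂ = algebraMap (ZMod p) (GaloisField p 2) g.val.trace ∧
    t₁ * t₂ = algebraMap (ZMod p) (GaloisField p 2) g.val.det ∧ t₁ ≠ 0 ∧ t₂ ≠ 0 ∧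
    (t₁ ^ p = t₂ ∧ t₂ ^ p = t₁ ∧ eigenFiber g = {t₁, t₂} ∨
      t₁ ^ p = t₁ ∧ t₂ ^ p = t₂ ∧ t₁ ≠ t₂ ∧ eigenFiber g = ∅) := by
  obtain ⟨t, ht⟩ := exists_root_quadratic g.val.trace g.val.det
  set τ := algebraMap (ZMod p) (GaloisField p 2) g.val.trace with hτ
  set D := algebraMap (ZMod p) (GaloisField p 2) g.val.det with hD
  have hτp : τ ^ p = τ := conj_base _
  have hDp : D ^ p = D := conj_base _
  have hD0 : D ≠ 0 := by
    rw [hD, Ne, map_eq_zero]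
    exact g.det.ne_zero
  obtain ⟨t', ht'⟩ : ∃ t', t + t' = τ := ⟨τ - t, by ring⟩
  have hmul : t * t' = D := by linear_combination t * ht' - ht
  have h0 : t ≠ 0 := fun h => hD0 (by rw [← hmul, h, zero_mul])
  have h0' : t' ≠ 0 := fun h => hD0 (by rw [← hmul, h, mul_zero])
  have hadd : t ^ p + t' ^ p = τ := by rw [← conj_add, ht', hτp]
  have hmulp : t ^ p * t' ^ p = D := by rw [← mul_pow, hmul, hDp]
  have hroots : ∀ s ∈ eigenFiber g, s = t ∨ s = t' := by
    intro s hs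
    rw [mem_eigenFiber] at hs
    have : (s - t) * (s - t') = 0 := by
      linear_combination s * hs.2 - hs.1 - s * ht' + hmul
    rcases mul_eq_zero.mp this with h | h
    · exact Or.inl (sub_eq_zero.mp h)
    · exact Or.inr (sub_eq_zero.mp h)
  have hconj : t ^ p = t ∨ t ^ p = t' := by
    have : (t ^ p - t) * (t ^ p - t') = 0 := by
      linear_combination t ^ p * hadd - hmulp - t ^ p * ht' + hmul
    rcases mul_eq_zero.mp this with h | h
    · exact Or.inl (sub_eq_zero.mp h)
    · exact Or.inr (sub_eq_zero.mp h)
  refine ⟨t, t', ht', hmul, h0, h0', ?_⟩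
  by_cases h : t ^ p = t'
  · left
    have h' : t' ^ p = t := by rw [← h, conj_conj]
    refine ⟨h, h', Finset.ext fun s => ?_⟩
    simp only [Finset.mem_insert, Finset.mem_singleton]
    refine ⟨hroots s, ?_⟩
    rintro (rfl | rfl)
    · rw [mem_eigenFiber, h]
      exact ⟨hmul, ht'⟩
    · rw [mem_eigenFiber, h', mul_comm, add_comm]
      exact ⟨hmul, ht'⟩
  · right
    have h1 : t ^ p = t := hconj.resolve_right h
    have h2 : t' ^ p = t' := by linear_combination hadd - h1 - ht'
    have hne : t ≠ t' := fun h' => h (h1.trans h')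
    refine ⟨h1, h2, hne, Finset.eq_empty_of_forall_notMem fun s hs => hne ?_⟩
    have hs' := (mem_eigenFiber.mp hs).2
    rcases hroots s hs with rfl | rfl
    · rw [h1] at hs'
      linear_combination hs' - ht'
    · rw [h2] at hs'
      linear_combination ht' - hs'

end CuspidalTrace

section JordanHolder

open Module

variable {k : Type*} [Field k]

lemma actionTrace_add {A : Type*} [Ring A] [Algebra k A] (M : Type*) [AddCommGroup M] [Module k M]
    [Module A M] [IsScalarTower k A M] (x y : A) :
    actionTrace k M (x + y) = actionTrace k M x + actionTrace k M y := by
  simp [actionTrace]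

lemma actionTrace_smul {A : Type*} [Ring A] [Algebra k A] (M : Type*) [AddCommGroup M] [Module k M]
    [Module A M] [IsScalarTower k A M] (c : k) (x : A) :
    actionTrace k M (c • x) = c * actionTrace k M x := by
  simp [actionTrace]

lemma actionTrace_zero {A : Type*} [Ring A] [Algebra k A] (M : Type*) [AddCommGroup M] [Module k M]
    [Module A M] [IsScalarTower k A M] : actionTrace k M (0 : A) = 0 := by
  simp [actionTrace]

variable {G : Type*} [Group G]

lemma actionTrace_asModule {M : Type*} [AddCommGroup M] [Module k M] (σ : Representation k G M)
    (g : G) : actionTrace k σ.asModule (MonoidAlgebra.single g (1 : k)) =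
      LinearMap.trace k M (σ g) := by
  have : (Algebra.lsmul k k σ.asModule (MonoidAlgebra.single g (1 : k)) :
      σ.asModule →ₗ[k] σ.asModule) = σ.asModuleEquiv.symm.conj (σ g) := by
    ext v
    apply σ.asModuleEquiv.injective
    rw [Algebra.lsmul_coe, Representation.asModuleEquiv_map_smul,
      Representation.asAlgebraHom_single_one]
    simp only [LinearEquiv.conj_apply, LinearMap.comp_apply, LinearEquiv.coe_coe,
      LinearEquiv.symm_symm, LinearEquiv.apply_symm_apply]
  rw [actionTrace, this, LinearMap.trace_conj']

lemma sum_subtype_eq_sum {ι R : Type*} [Fintype ι] [AddCommMonoid R] {P : ι → Prop}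
    [Fintype {i // P i}] {f : ι → R} (hf : ∀ i, ¬ P i → f i = 0) :
    ∑ i : {i // P i}, f i = ∑ i, f i := by
  classical
  rw [← Finset.sum_filter_of_ne (p := P) fun i _ hi => not_not.mp fun h => hi (hf i h)]
  exact (Finset.sum_subtype _ (by simp) f).symm

/-- A representation of dimension less than the characteristic whose trace is the sum of those of
irreducible representations has these as its Jordan–Hölder factors. -/
theorem hasJordanHolderFactors_of_trace_eq {p : ℕ} [CharP k p] {M : Type*} [AddCommGroup M]
    [Module k M] [Module.Finite k M] (σ : Representation k G M) {ι : Type*} [Fintype ι]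
    (X : ι → Rep k G) [∀ i, Module.Finite k (X i)]
    (hsimple : ∀ i, Nontrivial (X i) → IsSimpleModule (MonoidAlgebra k G) (X i).ρ.asModule)
    (hM : finrank k M < p) (hX : ∑ i, finrank k (X i) < p)
    (h : ∀ g, LinearMap.trace k M (σ g) = ∑ i, LinearMap.trace k (X i) ((X i).ρ g)) :
    HasJordanHolderFactors σ X := by
  classical
  have hs : ∀ i : {i // Nontrivial (X i)},
      IsSimpleModule (MonoidAlgebra k G) (X i).ρ.asModule := fun i => hsimple i i.2
  have htr : ∀ i g, ¬ Nontrivial (X i) → LinearMap.trace k (X i) ((X i).ρ g) = 0 := by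
    intro i g hi
    have := not_nontrivial_iff_subsingleton.mp hi
    rw [Subsingleton.elim ((X i).ρ g) 0, map_zero]
  have hdim : ∀ i, ¬ Nontrivial (X i) → finrank k (X i) = 0 := by
    intro i hi
    have := not_nontrivial_iff_subsingleton.mp hi
    exact finrank_zero_of_subsingleton
  have hfin : ∀ i, Module.Finite k (X i).ρ.asModule := fun i =>
    Module.Finite.equiv (X i).ρ.asModuleEquiv.symm
  have hdim' : ∀ i, finrank k (X i).ρ.asModule = finrank k (X i) := fun i =>
    (X i).ρ.asModuleEquiv.finrank_eq
  have key := exists_compositionSeries_of_actionTrace_eq (k := k) (A := MonoidAlgebra k G) (p := p)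
    (M := σ.asModule) (fun i : {i // Nontrivial (X i)} => (X i).ρ.asModule)
    (σ.asModuleEquiv.finrank_eq.trans_lt hM)
    (by simpa only [hdim', sum_subtype_eq_sum hdim] using hX)
    (fun x => by
      induction x using MonoidAlgebra.induction_linear with
      | zero => simp [actionTrace_zero]
      | add x y hx hy => simp only [actionTrace_add, hx, hy, Finset.sum_add_distrib]
      | single g c =>
        have : MonoidAlgebra.single g c = c • MonoidAlgebra.single g (1 : k) := by simp
        rw [this]
        simp only [actionTrace_smul, ← Finset.mul_sum, actionTrace_asModule]
        rw [h g, sum_subtype_eq_sum fun i => htr i g])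
  exact key

end JordanHolder

section LatticeTrace

open Module

variable {O E V : Type*} [CommRing O] [IsDomain O] [IsPrincipalIdealRing O] [Field E] [Algebra O E]
  [IsFractionRing O E] [AddCommGroup V] [Module E V] [Module O V] [IsScalarTower O E V]
  {G : Type*} [Group G]

lemma trace_eq_algebraMap_trace_latticeRep (ρ : Representation E G V) (L : Submodule O V)
    [L.IsLattice E] (hL : ∀ g, ∀ v ∈ L, ρ g v ∈ L) (g : G) :
    LinearMap.trace E V (ρ g) = algebraMap O E (LinearMap.trace O L (latticeRep ρ L hL g)) := by
  classical
  have : Module.Free O L := Submodule.IsLattice.free E L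
  let b := Module.Free.chooseBasis O L
  rw [LinearMap.trace_eq_matrix_trace O b, LinearMap.trace_eq_matrix_trace E
    (b.extendOfIsLattice E), Matrix.trace, Matrix.trace, map_sum]
  refine Finset.sum_congr rfl fun i _ => ?_
  rw [Matrix.diag_apply, Matrix.diag_apply, LinearMap.toMatrix_apply, LinearMap.toMatrix_apply]
  have h : ρ g (b.extendOfIsLattice E i) =
      ∑ l, algebraMap O E (b.repr (latticeRep ρ L hL g (b i)) l) • b.extendOfIsLattice E l := by
    have h1 : ρ g (b.extendOfIsLattice E i) = (latticeRep ρ L hL g (b i) : V) := by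
      rw [Basis.extendOfIsLattice_apply]
      rfl
    rw [h1]
    conv_lhs => rw [← b.sum_repr (latticeRep ρ L hL g (b i))]
    rw [AddSubmonoidClass.coe_finsetSum]
    refine Finset.sum_congr rfl fun l _ => ?_
    rw [Basis.extendOfIsLattice_apply, algebraMap_smul]
    rfl
  rw [h, Basis.repr_sum_self]

lemma finrank_lattice (L : Submodule O V) [L.IsLattice E] : finrank O L = finrank E V := by
  rw [finrank, finrank, Submodule.IsLattice.rank' E L]

end LatticeTrace

section Residue

variable {O : Type*} {Ω : Type*} [CommRing O] [Field Ω] [Algebra O Ω]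

/-- The residue field of `O` embeds into a residue field of the integral closure. -/
lemma exists_residueField_integralClosure [IsLocalRing O]
    (hinj : Function.Injective (algebraMap O Ω)) :
    ∃ (P : Ideal (integralClosure O Ω)) (_ : P.IsMaximal)
      (f : IsLocalRing.ResidueField O →+* integralClosure O Ω ⧸ P),
      ∀ x : O, f (IsLocalRing.residue O x) =
        Ideal.Quotient.mk P (algebraMap O (integralClosure O Ω) x) := by
  have : FaithfulSMul O (integralClosure O Ω) := by
    rw [faithfulSMul_iff_algebraMap_injective]
    intro x y hxy
    exact hinj (congrArg Subtype.val hxy)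
  obtain ⟨P, hP, hover⟩ := Ideal.exists_maximal_ideal_liesOver_of_isIntegral
    (S := integralClosure O Ω) (IsLocalRing.maximalIdeal O)
  refine ⟨P, hP, Ideal.Quotient.lift (IsLocalRing.maximalIdeal O)
    ((Ideal.Quotient.mk P).comp (algebraMap O (integralClosure O Ω))) fun x hx => ?_,
    fun x => rfl⟩
  rw [RingHom.comp_apply, Ideal.Quotient.eq_zero_iff_mem, ← Ideal.mem_comap]
  rwa [hover.over] at hx

variable {p : ℕ} [Fact p.Prime]

/-- A ring homomorphism from the Witt vectors of a perfect field to a ring of characteristic `p`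
factors through the residue field. -/
lemma exists_ringHom_teichmuller {F K : Type*} [Field F] [CharP F p] [PerfectRing F p] [CommRing K]
    [CharP K p] (h : WittVector p F →+* K) :
    ∃ ι : F →+* K, ∀ x, ι x = h (WittVector.teichmuller p x) := by
  let h' : WittVector p F ⧸ Ideal.span {(p : WittVector p F)} →+* K :=
    Ideal.Quotient.lift _ h fun x hx => by
      obtain ⟨y, rfl⟩ := Ideal.mem_span_singleton.mp hx
      rw [map_mul, map_natCast, CharP.cast_eq_zero, zero_mul]
  refine ⟨h'.comp (WittVector.quotientPEquiv (p := p) (k := F)).symm.toRingHom, fun x => ?_⟩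
  have : (WittVector.quotientPEquiv (p := p) (k := F)).symm x =
      Ideal.Quotient.mk _ (WittVector.teichmuller p x) := by
    rw [RingEquiv.symm_apply_eq]
    exact (WittVector.teichmuller_coeff_zero p x).symm
  change h' ((WittVector.quotientPEquiv (p := p) (k := F)).symm x) = _
  rw [this]
  rfl

/-- The values of `χ` at units lie in the integral closure. -/
lemma exists_coe_eq_chiChar (j : WittVector p (GaloisField p 2) →+* integralClosure O Ω) (a b : ℤ)
    {t : GaloisField p 2} (ht : t ≠ 0) {K : Type*} [Field K] (π : integralClosure O Ω →+* K) :
    ∃ y : integralClosure O Ω, (y : Ω) = chiChar j a b t ∧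
      π y = π (j (WittVector.teichmuller p t)) ^ a *
        π (j (WittVector.teichmuller p (t ^ p))) ^ b := by
  let w : (GaloisField p 2)ˣ →* (integralClosure O Ω)ˣ :=
    Units.map ((j : _ →* integralClosure O Ω).comp (WittVector.teichmuller p))
  let u := Units.mk0 t ht
  refine ⟨((w u ^ a * (w u ^ p) ^ b : (integralClosure O Ω)ˣ) : integralClosure O Ω), ?_, ?_⟩
  · have hθ : MulChar.toUnitHom (teichmullerChar j) = (Units.map
        (algebraMap (integralClosure O Ω) Ω).toMonoidHom).comp w := by
      ext x
      rfl
    have h1 : MulChar.toUnitHom (chiChar j a b) = MulChar.toUnitHom (teichmullerChar j) ^ a *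
        (MulChar.toUnitHom (teichmullerChar j) ^ p) ^ b := by
      change MulChar.mulEquivToUnitHom (chiChar j a b) = _
      rw [chiChar, map_mul, map_zpow, map_zpow, map_pow]
      rfl
    have h2 : chiChar j a b t = (MulChar.toUnitHom (chiChar j a b) u : Ωˣ) :=
      (MulChar.coe_toUnitHom _ u).symm
    rw [h2, h1, hθ]
    change ((Units.map (algebraMap (integralClosure O Ω) Ω).toMonoidHom
      (w u ^ a * (w u ^ p) ^ b) : Ωˣ) : Ω) = _
    congr 1
    rw [map_mul, map_zpow, map_zpow, map_pow]
    rfl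
  · change ((Units.map (π : _ →* K) (w u ^ a * (w u ^ p) ^ b) : Kˣ) : K) = _
    rw [map_mul, map_zpow, map_zpow, map_pow, Units.val_mul, Units.val_zpow_eq_zpow_val,
      Units.val_zpow_eq_zpow_val, Units.val_pow_eq_pow_val, map_pow, map_pow, map_pow]
    rfl

end Residue

section TraceIdentity

variable {p : ℕ} {K : Type*} [Field K]

/-- The traces of `det ⊗ Sym ^ (n - 2)` and `det ^ n ⊗ Sym ^ (p - 1 - n)` at an element with
eigenvalues `x`, `y`, multiplied by `x - y`. -/
lemma geom_sum_add_geom_sum_mul {n : ℕ} (hn : 1 ≤ n) (hnp : n ≤ p) (x y : K) :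
    (x * y * (∑ i ∈ Finset.range (n - 1), x ^ i * y ^ (n - 1 - 1 - i)) +
      (x * y) ^ n * ∑ i ∈ Finset.range (p - n), x ^ i * y ^ (p - n - 1 - i)) * (x - y) =
    x ^ n * y - x * y ^ n + y ^ n * x ^ p - x ^ n * y ^ p := by
  rw [add_mul, mul_assoc, mul_assoc ((x * y) ^ n), geom_sum₂_mul, geom_sum₂_mul]
  obtain ⟨s, rfl⟩ := Nat.exists_eq_add_of_le' hn
  obtain ⟨r, rfl⟩ := Nat.exists_eq_add_of_le hnp
  simp only [Nat.add_sub_cancel, Nat.add_sub_cancel_left, pow_add, pow_one, mul_pow]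
  ring

lemma geom_sum_add_geom_sum_self [CharP K p] {n : ℕ} (hn : 1 ≤ n) (hnp : n ≤ p) {x : K}
    (hx : x ^ p = x) :
    x * x * (∑ i ∈ Finset.range (n - 1), x ^ i * x ^ (n - 1 - 1 - i)) +
      (x * x) ^ n * ∑ i ∈ Finset.range (p - n), x ^ i * x ^ (p - n - 1 - i) = -x ^ n := by
  have h : ∀ s : ℕ, ∑ i ∈ Finset.range s, x ^ i * x ^ (s - 1 - i) = s * x ^ (s - 1) := by
    intro s
    rw [Finset.sum_congr rfl fun i hi => ?_, Finset.sum_const, Finset.card_range, nsmul_eq_mul]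
    rw [← pow_add]
    congr 1
    have := Finset.mem_range.mp hi
    omega
  have h1 : ∀ s : ℕ, x * (s * x ^ (s - 1)) = s * x ^ s := by
    rintro (_ | s)
    · simp
    · rw [Nat.add_sub_cancel, pow_succ]
      ring
  have h2 : x ^ n * x ^ (p - n) = x := by rw [← pow_add, Nat.add_sub_cancel' hnp, hx]
  have h3 : x * x ^ (n - 1) = x ^ n := by rw [← pow_succ', Nat.sub_add_cancel hn]
  rw [h, h]
  rcases eq_or_ne x 0 with rfl | hx0
  · rw [zero_pow (by omega : n ≠ 0)]
    simp [zero_pow (by omega : n ≠ 0)]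
  · apply mul_left_cancel₀ hx0
    have hcast1 : ((n - 1 : ℕ) : K) = n - 1 := by rw [Nat.cast_sub hn, Nat.cast_one]
    have hcast2 : ((p - n : ℕ) : K) = -n := by
      rw [Nat.cast_sub hnp, CharP.cast_eq_zero, zero_sub]
    have e1 := h1 (n - 1)
    have e2 := h1 (p - n)
    rw [hcast1] at e1 ⊢
    rw [hcast2] at e2 ⊢
    rw [mul_pow]
    linear_combination x * x * e1 + x ^ n * x ^ n * e2 + (n - 1) * x * h3 - n * x ^ n * h2

end TraceIdentity

section Main

variable {p : ℕ} [Fact p.Prime] {k : Type*} [Field k] [CharP k p]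

/-- The trace of `det ^ m ⊗ Sym ^ (s - 1)`, valid for `s = 0` as well. -/
lemma map_trace_detSymRep_sub_one {K : Type*} [Field K] (f : k →+* K) (m : ℤ) {n : ℤ} (s : ℕ)
    (hn : n = s - 1) (g : GL (Fin 2) (ZMod p)) {t₁ t₂ : K}
    (htr : t₁ + t₂ = f (ZMod.castHom (dvd_refl p) k g.val.trace))
    (hdet : t₁ * t₂ = f (ZMod.castHom (dvd_refl p) k g.val.det)) :
    f (LinearMap.trace k _ (detSymRep p k m n g)) =
      (t₁ * t₂) ^ m * ∑ i ∈ Finset.range s, t₁ ^ i * t₂ ^ (s - 1 - i) := by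
  subst hn
  rcases s with _ | s
  · have : Subsingleton (symSpace k (((0 : ℕ) : ℤ) - 1)) := by
      rw [symSpace_neg k (by simp)]
      infer_instance
    rw [Subsingleton.elim (detSymRep p k m (((0 : ℕ) : ℤ) - 1) g) 0, map_zero, map_zero]
    simp
  · have hs : (((s + 1 : ℕ) : ℤ) - 1) = s := by push_cast; ring
    rw [hs, map_trace_detSymRep f m s g htr hdet, ← Finset.sum_range_reflect]
    congr 1
    refine Finset.sum_congr rfl fun i hi => ?_
    have := Finset.mem_range.mp hi
    rw [show s - (s + 1 - 1 - i) = i by omega]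

/-- The sum of the traces of the two representations, in terms of the eigenvalues in `𝔽_{p²}`. -/
lemma map_trace_detSymRep_add {K : Type*} [Field K] [CharP K p] (f : k →+* K)
    (ι : GaloisField p 2 →+* K) {a b : ℤ} (hab : b < a) (hab' : a - b ≤ p)
    (g : GL (Fin 2) (ZMod p)) :
    f (LinearMap.trace k _ (detSymRep p k (b + 1) (a - b - 2) g)) +
      f (LinearMap.trace k _ (detSymRep p k a (p - 1 - (a - b)) g)) =
    -∑ t ∈ eigenFiber g, ι t ^ a * ι (t ^ p) ^ b := by
  classical
  obtain ⟨t₁, t₂, htr, hdet, h₁, h₂, hcase⟩ := exists_eigenvalues g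
  obtain ⟨n, hn⟩ : ∃ n : ℕ, a = b + n := ⟨(a - b).toNat, by omega⟩
  have hn1 : 1 ≤ n := by omega
  have hnp : n ≤ p := by omega
  have hcomp : ∀ s : ZMod p, ι (algebraMap (ZMod p) (GaloisField p 2) s) =
      f (ZMod.castHom (dvd_refl p) k s) := fun s =>
    RingHom.congr_fun (Subsingleton.elim (ι.comp (algebraMap (ZMod p) (GaloisField p 2)))
      (f.comp (ZMod.castHom (dvd_refl p) k))) s
  have htr' : ι t₁ + ι t₂ = f (ZMod.castHom (dvd_refl p) k g.val.trace) := by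
    rw [← map_add, htr, hcomp]
  have hdet' : ι t₁ * ι t₂ = f (ZMod.castHom (dvd_refl p) k g.val.det) := by
    rw [← map_mul, hdet, hcomp]
  rw [map_trace_detSymRep_sub_one f (b + 1) (n - 1) (by omega) g htr' hdet',
    map_trace_detSymRep_sub_one f a (p - n) (by omega) g htr' hdet']
  have hx : ι t₁ ≠ 0 := (map_ne_zero ι).mpr h₁
  have hy : ι t₂ ≠ 0 := (map_ne_zero ι).mpr h₂
  have hxp : ι t₁ ^ p = ι (t₁ ^ p) := (map_pow ι t₁ p).symm
  have hyp : ι t₂ ^ p = ι (t₂ ^ p) := (map_pow ι t₂ p).symm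
  have hfactor : ∀ A B : K, (ι t₁ * ι t₂) ^ (b + 1) * A + (ι t₁ * ι t₂) ^ a * B =
      (ι t₁ * ι t₂) ^ b * (ι t₁ * ι t₂ * A + (ι t₁ * ι t₂) ^ n * B) := by
    intro A B
    rw [hn, zpow_add₀ (mul_ne_zero hx hy), zpow_add₀ (mul_ne_zero hx hy), zpow_one, zpow_natCast]
    ring
  rw [hfactor]
  rcases hcase with ⟨hp₁, hp₂, hfib⟩ | ⟨hp₁, hp₂, hne, hfib⟩
  · by_cases heq : t₁ = t₂
    · subst heq
      rw [hp₁] at hxp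
      rw [geom_sum_add_geom_sum_self hn1 hnp hxp, hfib, Finset.insert_eq_of_mem (by simp),
        Finset.sum_singleton, hp₁, hn, zpow_add₀ hx, zpow_natCast, mul_zpow]
      ring
    · have hsub : ι t₁ - ι t₂ ≠ 0 := sub_ne_zero.mpr (ι.injective.ne heq)
      have key := geom_sum_add_geom_sum_mul hn1 hnp (ι t₁) (ι t₂)
      rw [hxp, hyp, hp₁, hp₂] at key
      have key' : ι t₁ * ι t₂ * (∑ i ∈ Finset.range (n - 1), ι t₁ ^ i * ι t₂ ^ (n - 1 - 1 - i)) +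
          (ι t₁ * ι t₂) ^ n * ∑ i ∈ Finset.range (p - n), ι t₁ ^ i * ι t₂ ^ (p - n - 1 - i) =
          -(ι t₁ ^ n + ι t₂ ^ n) := by
        apply mul_right_cancel₀ hsub
        rw [key]
        ring
      rw [key', hfib, Finset.sum_pair heq, hp₁, hp₂, hn, zpow_add₀ hx, zpow_add₀ hy, zpow_natCast,
        zpow_natCast, mul_zpow]
      ring
  · have hsub : ι t₁ - ι t₂ ≠ 0 := sub_ne_zero.mpr (ι.injective.ne hne)
    have key := geom_sum_add_geom_sum_mul hn1 hnp (ι t₁) (ι t₂)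
    rw [hxp, hyp, hp₁, hp₂] at key
    rw [hfib, Finset.sum_empty, neg_zero, mul_eq_zero]
    right
    apply mul_right_cancel₀ hsub
    rw [key]
    ring

end Main

section Reduction

variable {p : ℕ} [Fact p.Prime] {O : Type*} [CommRing O] [IsDomain O] [IsDiscreteValuationRing O]
  [CharP (IsLocalRing.ResidueField O) p] {E : Type*} [Field E] [Algebra O E] [IsFractionRing O E]
  {Ω : Type*} [Field Ω] [Algebra E Ω] [Algebra O Ω] [IsScalarTower O E Ω]
  {V : Type*} [AddCommGroup V] [Module E V] [Module O V] [IsScalarTower O E V]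

lemma finite_of_isLattice (L : Submodule O V) [L.IsLattice E] : Module.Finite E V :=
  have : Module.Free O L := Submodule.IsLattice.free E L
  Module.Finite.of_basis ((Module.Free.chooseBasis O L).extendOfIsLattice E)

variable {ρ : Representation E (GL (Fin 2) (ZMod p)) V}

lemma algebraMap_trace_eq_trace_equiv {W : Type*} [AddCommGroup W] [Module Ω W]
    [Module.Finite E V] {τ : Representation Ω (GL (Fin 2) (ZMod p)) W}
    (e : (baseChangeRep Ω ρ).Equiv τ) (g : GL (Fin 2) (ZMod p)) :
    algebraMap E Ω (LinearMap.trace E V (ρ g)) = LinearMap.trace Ω W (τ g) := by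
  have h : τ g = e.toLinearEquiv.conj (baseChangeRep Ω ρ g) := by
    ext w
    have := LinearMap.congr_fun (e.toIntertwiningMap.isIntertwining' g) (e.toLinearEquiv.symm w)
    refine Eq.trans ?_ this.symm
    exact congrArg (τ g) (e.toLinearEquiv.apply_symm_apply w).symm
  rw [h, LinearMap.trace_conj']
  exact (LinearMap.trace_baseChange (ρ g) Ω).symm

/-- The trace on the reduction of a lattice in the cuspidal representation. -/
lemma trace_reductionRep [CharZero Ω] {a b : ℤ} (hab : b < a) (hab' : a - b ≤ p)
    {j : WittVector p (GaloisField p 2) →+* integralClosure O Ω}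
    {hχ : chiChar j a b ^ p ≠ chiChar j a b} {ψ : AddChar (ZMod p) Ω} {hψ : ψ ≠ 1}
    (e : (baseChangeRep Ω ρ).Equiv (cuspidalRep (chiChar j a b) hχ ψ hψ))
    (L : Submodule O V) [L.IsLattice E] (hL : ∀ g, ∀ v ∈ L, ρ g v ∈ L)
    (g : GL (Fin 2) (ZMod p)) :
    LinearMap.trace (IsLocalRing.ResidueField O) _ (reductionRep ρ L hL g) =
      LinearMap.trace _ _ (detSymRep p (IsLocalRing.ResidueField O) (b + 1) (a - b - 2) g) +
      LinearMap.trace _ _ (detSymRep p (IsLocalRing.ResidueField O) a (p - 1 - (a - b)) g) := by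
  classical
  have : Module.Free O L := Submodule.IsLattice.free E L
  have : Module.Finite E V := finite_of_isLattice L
  have hinj : Function.Injective (algebraMap O Ω) := by
    rw [IsScalarTower.algebraMap_eq O E Ω]
    exact (algebraMap E Ω).injective.comp (IsFractionRing.injective O E)
  obtain ⟨P, hP, f, hf⟩ := exists_residueField_integralClosure hinj
  let : Field (integralClosure O Ω ⧸ P) := Ideal.Quotient.field P
  have : CharP (integralClosure O Ω ⧸ P) p := charP_of_injective_ringHom f.injective p
  obtain ⟨ι, hι⟩ := exists_ringHom_teichmuller ((Ideal.Quotient.mk P).comp j)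
  choose! y hy hπy using fun (t : GaloisField p 2) (ht : t ≠ 0) =>
    exists_coe_eq_chiChar j a b ht (Ideal.Quotient.mk P)
  have hne : ∀ t ∈ eigenFiber g, t ≠ 0 := by
    rintro t ht rfl
    have h := (mem_eigenFiber.mp ht).1
    rw [zero_mul, eq_comm, map_eq_zero] at h
    exact g.det.ne_zero h
  obtain ⟨c, hc⟩ : ∃ c : integralClosure O Ω, (c : Ω) =
      if g 1 0 = 0 ∧ g 0 1 = 0 ∧ g 0 0 = g 1 1 then
        chiChar j a b (algebraMap (ZMod p) (GaloisField p 2) (g 1 1)) else 0 := by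
    split_ifs with h
    · refine ⟨_, hy _ ?_⟩
      rw [Ne, map_eq_zero]
      intro h0
      refine g.det.ne_zero ?_
      change g.val.det = 0
      rw [Matrix.det_fin_two, h0, h.1]
      simp
    · exact ⟨0, rfl⟩
  apply f.injective
  rw [map_add, map_trace_detSymRep_add f ι hab hab' g]
  have h1 : LinearMap.trace (IsLocalRing.ResidueField O) _ (reductionRep ρ L hL g) =
      IsLocalRing.residue O (LinearMap.trace O L (latticeRep ρ L hL g)) :=
    LinearMap.trace_baseChange _ _
  have h2 : algebraMap O (integralClosure O Ω) (LinearMap.trace O L (latticeRep ρ L hL g)) =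
      -∑ t ∈ eigenFiber g, y t + p * c := by
    apply Subtype.ext
    have h3 : algebraMap O Ω (LinearMap.trace O L (latticeRep ρ L hL g)) =
        LinearMap.trace Ω _ (cuspidalRep (chiChar j a b) hχ ψ hψ g) := by
      rw [IsScalarTower.algebraMap_apply O E Ω, ← trace_eq_algebraMap_trace_latticeRep,
        algebraMap_trace_eq_trace_equiv e]
    refine h3.trans ?_
    rw [trace_cuspidalRep]
    push_cast
    rw [hc, Finset.sum_congr rfl fun t ht => hy t (hne t ht)]
  rw [h1, hf, h2, map_add, map_neg, map_sum, map_mul, map_natCast, CharP.cast_eq_zero, zero_mul,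
    add_zero, Finset.sum_congr rfl fun t ht => hπy t (hne t ht)]
  simp only [hι, RingHom.comp_apply]

end Reduction

end CuspidalGL2

end

theorem lemma4p2 (p : ℕ) [Fact p.Prime] (a b : ℤ) (hab : b < a) (hab' : a - b ≤ p)
    (O : Type*) [CommRing O] [IsDomain O] [IsDiscreteValuationRing O] [CharP (IsLocalRing.ResidueField O) p]
    (E : Type*) [Field E] [CharZero E] [Algebra O E] [IsFractionRing O E]
    (Ω : Type*) [Field Ω] [CharZero Ω] [Algebra E Ω] [Algebra O Ω] [IsScalarTower O E Ω]
    (j : WittVector p (GaloisField p 2) →+* integralClosure O Ω)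
    (hχ : CuspidalGL2.chiChar j a b ^ p ≠ CuspidalGL2.chiChar j a b)
    (ψ : AddChar (ZMod p) Ω) (hψ : ψ ≠ 1)
    (V : Type*) [AddCommGroup V] [Module E V] [Module O V] [IsScalarTower O E V]
    (ρ : Representation E (GL (Fin 2) (ZMod p)) V)
    (hρ : Nonempty ((CuspidalGL2.baseChangeRep Ω ρ).Equiv (CuspidalGL2.cuspidalRep (CuspidalGL2.chiChar j a b) hχ ψ hψ)))
    (L : Submodule O V) [L.IsLattice E] (hL : ∀ g, ∀ v ∈ L, ρ g v ∈ L) :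
    CuspidalGL2.HasJordanHolderFactors (CuspidalGL2.reductionRep ρ L hL)
      ![Rep.of (CuspidalGL2.detSymRep p (IsLocalRing.ResidueField O) (b + 1) (a - b - 2)),
        Rep.of (CuspidalGL2.detSymRep p (IsLocalRing.ResidueField O) a (p - 1 - (a - b)))] := by
  obtain ⟨e⟩ := hρ
  have hp : p.Prime := Fact.out
  have : Module.Free O L := Submodule.IsLattice.free E L
  have hVfin : Module.Finite E V := CuspidalGL2.finite_of_isLattice L
  have hsimple : ∀ m n : ℤ, n < p → Nontrivial (CuspidalGL2.symSpace (IsLocalRing.ResidueField O) n) →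
      IsSimpleModule (MonoidAlgebra (IsLocalRing.ResidueField O) (GL (Fin 2) (ZMod p)))
        (CuspidalGL2.detSymRep p (IsLocalRing.ResidueField O) m n).asModule := by
    intro m n hn hnt
    rcases lt_or_ge n 0 with h | h
    · rw [CuspidalGL2.symSpace_neg _ h] at hnt
      exact absurd hnt (not_nontrivial _)
    · exact CuspidalGL2.isSimpleModule_detSymRep m n h hn
  have hfin : ∀ i, Module.Finite (IsLocalRing.ResidueField O)
      ((![Rep.of (CuspidalGL2.detSymRep p (IsLocalRing.ResidueField O) (b + 1) (a - b - 2)),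
        Rep.of (CuspidalGL2.detSymRep p (IsLocalRing.ResidueField O) a (p - 1 - (a - b)))] :
        Fin 2 → Rep _ _) i) := by
    rw [Fin.forall_fin_two]
    exact ⟨CuspidalGL2.finite_symSpace _, CuspidalGL2.finite_symSpace _⟩
  refine CuspidalGL2.hasJordanHolderFactors_of_trace_eq (p := p) _ _ ?_ ?_ ?_ fun g => ?_
  · rw [Fin.forall_fin_two]
    exact ⟨hsimple _ _ (by omega), hsimple _ _ (by omega)⟩
  · have h1 : Module.finrank Ω (TensorProduct E Ω V) = p - 1 := by
      rw [e.toLinearEquiv.finrank_eq, Module.finrank_fintype_fun_eq_card, ZMod.card_units]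
    rw [Module.finrank_baseChange, CuspidalGL2.finrank_lattice (E := E),
      ← Module.finrank_baseChange (R := Ω), h1]
    exact Nat.sub_lt hp.pos one_pos
  · rw [Fin.sum_univ_two]
    refine (congrArg₂ (· + ·) (CuspidalGL2.finrank_symSpace _ (a - b - 2))
      (CuspidalGL2.finrank_symSpace _ (p - 1 - (a - b)))).trans_lt ?_
    have := hp.pos
    omega
  · rw [Fin.sum_univ_two]
    exact CuspidalGL2.trace_reductionRep hab hab' e L hL g
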